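/- Let $n\ge 1$ and let $\mathfrak g=\mathfrak{osp}(1|2n)$ be the complex Lie superalgebra generated by odd elements $B_j^{+},B_j^{-}$ ($1\le j\le n$) subject to $$[\{B_i^\xi,B_j^\eta\},B_l^\epsilon]=(\epsilon-\eta)\delta_{jl}B_i^\xi+(\epsilon-\xi)\delta_{il}B_j^\eta ,\qquad \xi,\eta,\epsilon\in\{+,-\}=\{+1,-1\},$$ where $\{x,y\}=xy+yx$ and $[x,y]=xy-yx$ in the enveloping algebra $U(\mathfrak g)$. Put $E_{ij}=\tfrac12\{B_i^+,B_j^-\}$; these span a subalgebra $\mathfrak t=\mathfrak{gl}(n)$. Let $\mathfrak h=\operatorname{span}\{E_{ii}\}$, $\mathfrak t^+=\operatorname{span}\{E_{ij}:i<j\}$, let $R(\mathfrak h)$ be the field of fractions of $U(\mathfrak h)$, and let $U'(\mathfrak g)=U(\mathfrak g)\otimes_{U(\mathfrak h)}R(\mathfrak h)$ be the localization of $U(\mathfrak g)$ at $U(\mathfrak h)\setminus\{0\}$. Let $\mathfrak J'=U'(\mathfrak g)\mathfrak t^+$, $M'(\mathfrak g,\mathfrak t)=U'(\mathfrak g)/\mathfrak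 J'$, $\operatorname{Norm}\mathfrak J'=\{v\in U'(\mathfrak g):\mathfrak J'v\subset\mathfrak J'\}$, and let $$Z(\mathfrak g,\mathfrak t)=(\operatorname{Norm}\mathfrak J')/\mathfrak J'\subset M'(\mathfrak g,\mathfrak t)$$ be the Mickelsson–Zhelobenko algebra. With $h_i=E_{ii}-i+1$ and $(x)_k=x(x+1)\cdots(x+k-1)$, for $i<j$ the series $$\mathbf p_{ij}=\sum_{k\ge0}\frac{(-1)^k}{k!}E_{ji}^kE_{ij}^k\frac1{(h_i-h_j+1)_k}$$ acts on $M'(\mathfrak g,\mathfrak t)$ (on each vector only finitely many terms are nonzero); let $\mathbf p=\mathbf p_{12}\,\mathbf p_{13}\mathbf p_{23}\cdots\mathbf p_{1n}\cdots\mathbf p_{n-1,n}$ be the extremal projector of $\mathfrak{gl}(n)$. Then the elements $\mathbf pB_j^{\pm}$ ($1\le j\le n$) and $\mathbf p\{B_i^{\pm},B_j^{\pm}\}$ ($1\le i\le j\le n$, equal signs) of $M'(\mathfrak g,\mathfrak t)$ lie in $Z(\mathfrak g,\mathfrak t)$, and they generate $Z(\mathfrak g,\mathfrak t)$ as an algebra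 over $R(\mathfrak h)$: the smallest subring of $Z(\mathfrak g,\mathfrak t)$ that contains the image of $R(\mathfrak h)$ and all these elements is $Z(\mathfrak g,\mathfrak t)$ itself. -/

import Mathlib

/-! # The Mickelsson-Zhelobenko algebra of the pair `osp(1|2n)`, `gl(n)` -/

namespace OspMZ

open MvPolynomial

/-- The defining relations of `osp(1|2n)`, as relations between noncommutative polynomials in the
symbols `B_j^ε` (`ε` is `1` or `-1`):
`[{B_i^ξ, B_j^η}, B_l^ε] = (ε - η) δ_jl B_i^ξ + (ε - ξ) δ_il B_j^η`,
where `{x, y} = x * y + y * x` and `[x, y] = ⁅x, y⁆ = x * y - y * x`. -/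
inductive Rel (n : ℕ) :
    FreeAlgebra ℂ (ℤˣ × Fin n) → FreeAlgebra ℂ (ℤˣ × Fin n) → Prop
  | triple (ξ η ε : ℤˣ) (i j l : Fin n) :
      Rel n
        (⁅FreeAlgebra.ι ℂ (ξ, i) * FreeAlgebra.ι ℂ (η, j)
            + FreeAlgebra.ι ℂ (η, j) * FreeAlgebra.ι ℂ (ξ, i), FreeAlgebra.ι ℂ (ε, l)⁆)
        ((if j = l then (((ε : ℤ) : ℂ) - ((η : ℤ) : ℂ)) else 0) • FreeAlgebra.ι ℂ (ξ, i)
          + (if i = l then (((ε : ℤ) : ℂ) - ((ξ : ℤ) : ℂ)) else 0) • FreeAlgebra.ι ℂ (η, j))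

/-- The universal enveloping algebra `U(osp(1|2n))` over `ℂ`. As the Lie superalgebra `osp(1|2n)` is
presented by the odd generators `B_j^ε` and the relations `Rel`, its enveloping algebra is the
associative unital algebra with the same presentation. -/
def U (n : ℕ) : Type := RingQuot (Rel n)

noncomputable instance instRingU (n : ℕ) : Ring (U n) :=
  inferInstanceAs (Ring (RingQuot (Rel n)))

noncomputable instance instAlgebraU (n : ℕ) : Algebra ℂ (U n) :=
  inferInstanceAs (Algebra ℂ (RingQuot (Rel n)))

/-- The projection of the free algebra onto `U(osp(1|2n))`. -/
noncomputable def mkU (n : ℕ) : FreeAlgebra ℂ (ℤˣ × Fin n) →ₐ[ℂ] U n :=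
  RingQuot.mkAlgHom ℂ (Rel n)

theorem mkU_surjective (n : ℕ) : Function.Surjective (mkU n) :=
  RingQuot.mkAlgHom_surjective ℂ (Rel n)

theorem mkU_rel {n : ℕ} {x y : FreeAlgebra ℂ (ℤˣ × Fin n)} (h : Rel n x y) :
    mkU n x = mkU n y :=
  RingQuot.mkAlgHom_rel ℂ h

variable {n : ℕ}

/-- The odd generators `B_j^+ = B 1 j` and `B_j^- = B (-1) j`. -/
noncomputable def B (ε : ℤˣ) (j : Fin n) : U n :=
  mkU n (FreeAlgebra.ι ℂ (ε, j))

/-- The anticommutator `{B_i^ξ, B_j^η}`. -/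
noncomputable def BB (ξ η : ℤˣ) (i j : Fin n) : U n := B ξ i * B η j + B η j * B ξ i

/-- The basis elements `E_ij = (1/2) {B_i^+, B_j^-}` of `gl(n)` inside `osp(1|2n)`. -/
noncomputable def E (i j : Fin n) : U n := (1 / 2 : ℂ) • BB 1 (-1) i j

theorem BB_lie_B (ξ η ε : ℤˣ) (i j l : Fin n) :
    ⁅BB ξ η i j, B ε l⁆ = (if j = l then (((ε : ℤ) : ℂ) - ((η : ℤ) : ℂ)) else 0) • B ξ i
      + (if i = l then (((ε : ℤ) : ℂ) - ((ξ : ℤ) : ℂ)) else 0) • B η j := by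
  have h := mkU_rel (Rel.triple ξ η ε i j l)
  simpa only [map_add, map_mul, map_smul, Ring.lie_def, map_sub, B, BB] using h

theorem E_lie_B (i j l : Fin n) (ε : ℤˣ) :
    ⁅E i j, B ε l⁆ = (if j = l then ((((ε : ℤ) : ℂ) + 1) / 2) else 0) • B 1 i
      + (if i = l then ((((ε : ℤ) : ℂ) - 1) / 2) else 0) • B (-1) j := by
  have h := BB_lie_B 1 (-1) ε i j l
  rw [Ring.lie_def] at h
  rw [E, Ring.lie_def, smul_mul_assoc, mul_smul_comm, ← smul_sub, h, smul_add, smul_smul, smul_smul]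
  congr 2
  · split_ifs <;> simp; ring
  · split_ifs <;> simp; ring

/-- The weight `ε ε_l` of the generator `B_l^ε`, in coordinates dual to the `E_ii`. -/
def wt (ε : ℤˣ) (l : Fin n) : Fin n → ℂ := Pi.single l ((ε : ℤ) : ℂ)

theorem E_diag_lie_B (i l : Fin n) (ε : ℤˣ) :
    ⁅E i i, B ε l⁆ = (wt ε l i) • B ε l := by
  rw [E_lie_B]
  rcases Int.units_eq_one_or ε with rfl | rfl <;> by_cases h : i = l
  all_goals first | subst h | skip
  all_goals simp [wt, *]
  norm_num

theorem U_induction {P : U n → Prop} (hs : ∀ c : ℂ, P (algebraMap ℂ (U n) c))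
    (hB : ∀ ε j, P (B ε j)) (hm : ∀ x y, P x → P y → P (x * y))
    (ha : ∀ x y, P x → P y → P (x + y)) (x : U n) : P x := by
  obtain ⟨y, rfl⟩ := mkU_surjective n x
  induction y using FreeAlgebra.induction with
  | grade0 r => simpa using hs r
  | grade1 p => exact hB p.1 p.2
  | mul a b h1 h2 => rw [map_mul]; exact hm _ _ h1 h2
  | add a b h1 h2 => rw [map_add]; exact ha _ _ h1 h2

theorem E_commute (i j : Fin n) : E i i * E j j = E j j * E i i := by
  have h1 : ⁅E i i, E j j⁆ = (0 : U n) := by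
    have a := E_diag_lie_B i j 1
    have b := E_diag_lie_B i j (-1)
    rw [Ring.lie_def, sub_eq_iff_eq_add] at a b ⊢
    have c : wt 1 j i + wt (-1) j i = 0 := by
      by_cases h : i = j
      · subst h; simp [wt]
      · simp [wt, h]
    have key : E i i * BB 1 (-1) j j = BB 1 (-1) j j * E i i
        + (wt 1 j i + wt (-1) j i) • BB 1 (-1) j j := by
      simp only [BB, mul_add, add_mul, smul_add, add_smul]
      rw [← mul_assoc, a, ← mul_assoc, b]
      simp only [add_mul, mul_assoc, a, b, mul_add, smul_mul_assoc, mul_smul_comm]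
      abel
    rw [c, zero_smul, add_zero] at key
    have h2 : E j j = (1 / 2 : ℂ) • BB 1 (-1) j j := rfl
    rw [h2, zero_add, mul_smul_comm, key, smul_mul_assoc]
  rwa [Ring.lie_def, sub_eq_zero] at h1

/-- The enveloping algebra `U(h)` of the (abelian) Cartan subalgebra `h` with basis
`E_11, ..., E_nn`: the polynomial algebra in `n` variables, `X i` standing for `E_ii`. -/
abbrev Uh (n : ℕ) : Type := MvPolynomial (Fin n) ℂ

/-- The `E_ii` generate a commutative subalgebra. -/
instance instCartanComm (n : ℕ) :
    IsMulCommutative (Algebra.adjoin ℂ (Set.range fun i : Fin n => (E i i : U n))) :=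
  Algebra.isMulCommutative_adjoin ℂ (by
    rintro _ ⟨i, rfl⟩ _ ⟨j, rfl⟩
    exact E_commute i j)

open scoped IsMulCommutative in
/-- The algebra homomorphism from `U(h)` to `U(osp(1|2n))` sending `X i` to `E_ii`. -/
noncomputable def cartan (n : ℕ) : Uh n →ₐ[ℂ] U n :=
  (Algebra.adjoin ℂ (Set.range fun i : Fin n => (E i i : U n))).val.comp
    (aeval (S₁ := Algebra.adjoin ℂ (Set.range fun i : Fin n => (E i i : U n)))
      fun i => ⟨E i i, Algebra.subset_adjoin ⟨i, rfl⟩⟩)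

open scoped IsMulCommutative in
theorem cartan_X (i : Fin n) : cartan n (X i) = E i i := by
  simp [cartan]

/-- The automorphism `f(h) ↦ f(h + μ)` of `U(h)`. -/
noncomputable def shift (μ : Fin n → ℂ) : Uh n →ₐ[ℂ] Uh n := aeval fun i => X i + C (μ i)

theorem shift_shift (μ ν : Fin n → ℂ) (f : Uh n) : shift μ (shift ν f) = shift (μ + ν) f := by
  have : (shift μ).comp (shift ν) = shift (μ + ν) := by
    ext i
    simp [shift, add_assoc]
  exact DFunLike.congr_fun this f

theorem shift_zero (f : Uh n) : shift 0 f = f := by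
  have : shift (0 : Fin n → ℂ) = AlgHom.id ℂ _ := by
    ext i
    simp [shift]
  exact DFunLike.congr_fun this f

theorem shift_neg_shift (μ : Fin n → ℂ) (f : Uh n) : shift μ (shift (-μ) f) = f := by
  rw [shift_shift, add_neg_cancel, shift_zero]

theorem shift_ne_zero (μ : Fin n → ℂ) {f : Uh n} (hf : f ≠ 0) : shift μ f ≠ 0 := by
  intro h
  apply hf
  have := shift_neg_shift (-μ) f
  rw [neg_neg, h, map_zero] at this
  exact this.symm

/-- `x` is a weight vector of weight `μ` for the adjoint action of `h`: `f(h) x = x f(h + μ)`. -/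
def HasWeight (μ : Fin n → ℂ) (x : U n) : Prop :=
  ∀ f : Uh n, cartan n f * x = x * cartan n (shift μ f)

theorem hasWeight_of_lie {μ : Fin n → ℂ} {x : U n} (h : ∀ i, ⁅E i i, x⁆ = μ i • x) :
    HasWeight μ x := by
  intro f
  induction f using MvPolynomial.induction_on with
  | C a =>
    rw [show (C a : Uh n) = algebraMap ℂ _ a from rfl, AlgHom.commutes, AlgHom.commutes,
      AlgHom.commutes, Algebra.commutes]
  | add p q hp hq => simp only [map_add, add_mul, mul_add, hp, hq]
  | mul_X p i hp =>
    have hi := h i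
    rw [Ring.lie_def, sub_eq_iff_eq_add] at hi
    have e : cartan n (shift μ (X i)) = E i i + algebraMap ℂ _ (μ i) := by
      rw [shift, aeval_X, map_add, cartan_X, show (C (μ i) : Uh n) = algebraMap ℂ _ (μ i) from rfl,
        AlgHom.commutes]
    rw [map_mul, map_mul, map_mul, cartan_X, mul_assoc, hi, e, ← mul_assoc, ← hp, mul_add, mul_add,
      add_comm, mul_assoc, mul_assoc, mul_smul_comm, Algebra.smul_def, Algebra.commutes, mul_assoc]

theorem HasWeight.lie {μ : Fin n → ℂ} {x : U n} (h : HasWeight μ x) (i : Fin n) :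
    ⁅E i i, x⁆ = μ i • x := by
  have := h (X i)
  rw [shift, aeval_X, map_add, cartan_X, show (C (μ i) : Uh n) = algebraMap ℂ _ (μ i) from rfl,
    AlgHom.commutes, mul_add, ← Algebra.commutes, ← Algebra.smul_def] at this
  rw [Ring.lie_def, this, add_sub_cancel_left]

theorem hasWeight_B (ε : ℤˣ) (j : Fin n) : HasWeight (wt ε j) (B ε j : U n) :=
  hasWeight_of_lie fun i => E_diag_lie_B i j ε

theorem hasWeight_algebraMap (c : ℂ) : HasWeight 0 (algebraMap ℂ (U n) c) := by
  intro f
  rw [shift_zero, Algebra.commutes]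

theorem HasWeight.mul {μ ν : Fin n → ℂ} {x y : U n} (hx : HasWeight μ x) (hy : HasWeight ν y) :
    HasWeight (ν + μ) (x * y) := by
  intro f
  rw [← mul_assoc, hx, mul_assoc, hy, shift_shift, mul_assoc]

theorem HasWeight.add {μ : Fin n → ℂ} {x y : U n} (hx : HasWeight μ x) (hy : HasWeight μ y) :
    HasWeight μ (x + y) := by
  intro f
  rw [mul_add, add_mul, hx, hy]

theorem HasWeight.smul {μ : Fin n → ℂ} {x : U n} (c : ℂ) (hx : HasWeight μ x) :
    HasWeight μ (c • x) := by
  intro f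
  rw [mul_smul_comm, hx, smul_mul_assoc]

/-- The space of vectors of weight `μ` in `U(osp(1|2n))`. -/
def weightSpace (μ : Fin n → ℂ) : Submodule ℂ (U n) where
  carrier := {x | HasWeight μ x}
  add_mem' := HasWeight.add
  zero_mem' f := by simp
  smul_mem' c _ := HasWeight.smul c

theorem iSup_weightSpace : (⨆ μ, weightSpace μ : Submodule ℂ (U n)) = ⊤ := by
  rw [eq_top_iff]
  rintro x -
  induction x using U_induction with
  | hs c => exact Submodule.mem_iSup_of_mem 0 (hasWeight_algebraMap c)
  | hB ε j => exact Submodule.mem_iSup_of_mem _ (hasWeight_B ε j)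
  | ha x y hx hy => exact Submodule.add_mem _ hx hy
  | hm x y hx hy =>
    have h := Submodule.mul_mem_mul hx hy
    rw [Submodule.iSup_mul] at h
    revert h
    generalize x * y = z
    revert z
    change (_ : Submodule ℂ (U n)) ≤ _
    refine iSup_le fun μ => ?_
    rw [Submodule.mul_iSup]
    refine iSup_le fun ν => Submodule.mul_le.2 fun a ha b hb => ?_
    exact Submodule.mem_iSup_of_mem (ν + μ) (HasWeight.mul ha hb)

/-- The operator `x ↦ [E_ii, x]`. -/
noncomputable def adE (i : Fin n) : Module.End ℂ (U n) :=
  LinearMap.mulLeft ℂ (E i i) - LinearMap.mulRight ℂ (E i i)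

theorem iSupIndep_weightSpace : iSupIndep (weightSpace : (Fin n → ℂ) → Submodule ℂ (U n)) := by
  have hc : ∀ i j : Fin n, Commute (adE i : Module.End ℂ (U n)) (adE j) := by
    intro i j
    ext x
    have := E_commute i j
    simp only [adE, Module.End.mul_apply, LinearMap.sub_apply, LinearMap.mulLeft_apply,
      LinearMap.mulRight_apply, mul_sub, sub_mul]
    rw [← mul_assoc, this, mul_assoc _ (E i i) (E j j), this]
    simp only [mul_assoc]
    abel
  refine (Module.End.independent_iInf_maxGenEigenspace_of_forall_mapsTo
    (fun i : Fin n => (adE i : Module.End ℂ (U n)))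
    (fun i j c => Module.End.mapsTo_maxGenEigenspace_of_comm (hc j i) c)).mono fun μ x hx => ?_
  rw [Submodule.mem_iInf]
  intro i
  refine Module.End.mem_maxGenEigenspace _ _ _ |>.2 ⟨1, ?_⟩
  have := HasWeight.lie hx i
  rw [Ring.lie_def] at this
  simp [adE, this]

/-- The set of denominators: the nonzero elements of `U(h)`, inside `U(osp(1|2n))`. -/
noncomputable def denoms (n : ℕ) : Submonoid (U n) :=
  (nonZeroDivisors (Uh n)).map (cartan n)

theorem exists_left_ore (f : Uh n) (hf : f ≠ 0) (r : U n) :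
    ∃ g : Uh n, g ≠ 0 ∧ ∃ r' : U n, cartan n g * r = r' * cartan n f := by
  revert f
  induction r using U_induction with
  | hs c => exact fun f hf => ⟨f, hf, _, (Algebra.commutes _ _).symm⟩
  | hB ε j =>
    refine fun f hf => ⟨shift (-wt ε j) f, shift_ne_zero _ hf, B ε j, ?_⟩
    rw [hasWeight_B, shift_neg_shift]
  | hm x y hx hy =>
    intro f hf
    obtain ⟨g, hg, y', h1⟩ := hy f hf
    obtain ⟨k, hk, x', h2⟩ := hx g hg
    refine ⟨k, hk, x' * y', ?_⟩
    rw [← mul_assoc, h2, mul_assoc, h1, mul_assoc]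
  | ha x y hx hy =>
    intro f hf
    obtain ⟨g, hg, y', h1⟩ := hy f hf
    obtain ⟨k, hk, x', h2⟩ := hx f hf
    refine ⟨g * k, mul_ne_zero hg hk, cartan n g * x' + cartan n k * y', ?_⟩
    rw [mul_add, map_mul, mul_assoc, h2, ← map_mul, mul_comm g k, map_mul, mul_assoc, h1, add_mul,
      mul_assoc, mul_assoc]

theorem exists_left_cancel (f : Uh n) (hf : f ≠ 0) (r : U n) (h : r * cartan n f = 0) :
    ∃ g : Uh n, g ≠ 0 ∧ cartan n g * r = 0 := by
  classical
  have hr : r ∈ (⨆ μ, weightSpace μ : Submodule ℂ (U n)) := iSup_weightSpace ▸ Submodule.mem_top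
  obtain ⟨x, hx, rfl⟩ := (Submodule.mem_iSup_iff_exists_finsupp _ _).1 hr
  have h0 : ∀ μ ∈ x.support, x μ * cartan n f = 0 := by
    refine (iSupIndep_iff_finsetSum_eq_zero_imp_eq_zero _).1 iSupIndep_weightSpace _
      (fun μ => x μ * cartan n f) (fun μ hμ g => ?_) ?_
    · rw [← mul_assoc, hx μ, mul_assoc, mul_assoc, ← map_mul, ← map_mul, mul_comm]
    · rwa [Finsupp.sum, Finset.sum_mul] at h
  refine ⟨∏ μ ∈ x.support, shift (-μ) f,
    Finset.prod_ne_zero_iff.2 fun μ _ => shift_ne_zero _ hf, ?_⟩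
  rw [Finsupp.sum, Finset.mul_sum]
  refine Finset.sum_eq_zero fun μ hμ => ?_
  rw [← Finset.prod_erase_mul _ _ hμ, map_mul, mul_assoc, hx μ, shift_neg_shift, h0 μ hμ, mul_zero]

theorem nonempty_oreSet (n : ℕ) : Nonempty (OreLocalization.OreSet (denoms n)) := by
  rw [OreLocalization.nonempty_oreSet_iff]
  constructor
  · rintro r₁ r₂ ⟨_, f, hf, rfl⟩ h
    obtain ⟨g, hg, hr⟩ := exists_left_cancel f (nonZeroDivisors.ne_zero hf) (r₁ - r₂) (by
      rw [sub_mul, sub_eq_zero]; exact h)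
    refine ⟨⟨_, g, mem_nonZeroDivisors_of_ne_zero hg, rfl⟩, ?_⟩
    rwa [mul_sub, sub_eq_zero] at hr
  · rintro r ⟨_, f, hf, rfl⟩
    obtain ⟨g, hg, r', hr⟩ := exists_left_ore f (nonZeroDivisors.ne_zero hf) r
    exact ⟨r', ⟨_, g, mem_nonZeroDivisors_of_ne_zero hg, rfl⟩, hr⟩

/-- The nonzero elements of `U(h)` satisfy the Ore condition in `U(osp(1|2n))`. -/
noncomputable instance instOreSet (n : ℕ) : OreLocalization.OreSet (denoms n) :=
  (nonempty_oreSet n).some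

/-- The field of fractions `R(h)` of `U(h)`. -/
abbrev Rh (n : ℕ) : Type := FractionRing (Uh n)

/-- The extension `U'(g) = U(g) ⊗_{U(h)} R(h)` as an algebra: the Ore localization of
`U(osp(1|2n))` at the nonzero elements of `U(h)`. -/
abbrev UExt (n : ℕ) : Type := OreLocalization (denoms n) (U n)

/-- The canonical homomorphism `U(g) → U'(g)`. -/
noncomputable def toUExt (n : ℕ) : U n →+* UExt n := OreLocalization.numeratorRingHom

/-- The restriction to nonzero elements of the map `U(h) → U'(g)`. -/
noncomputable def denomHom (n : ℕ) : nonZeroDivisors (Uh n) →* UExt n :=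
  ((toUExt n).comp (cartan n).toRingHom).toMonoidHom.comp (nonZeroDivisors (Uh n)).subtype

theorem isUnit_denomHom (f : nonZeroDivisors (Uh n)) : IsUnit (denomHom n f) :=
  OreLocalization.numerator_isUnit (⟨cartan n f, f, f.2, rfl⟩ : denoms n)

/-- The canonical homomorphism `R(h) → U'(g)`, `f / g ↦ g⁻¹ f`. -/
noncomputable def rhToUExt (n : ℕ) : Rh n →+* UExt n :=
  OreLocalization.universalHom ((toUExt n).comp (cartan n).toRingHom)
    (IsUnit.liftRight (denomHom n) isUnit_denomHom) (fun _ => rfl)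

theorem rhToUExt_algebraMap (f : Uh n) :
    rhToUExt n (algebraMap (Uh n) (Rh n) f) = toUExt n (cartan n f) :=
  OreLocalization.universalHom_commutes ((toUExt n).comp (cartan n).toRingHom)
    (IsUnit.liftRight (denomHom n) isUnit_denomHom) (fun _ => rfl)

/-- The left ideal `J' = U'(g) t⁺`, where `t⁺` is spanned by the `E_ij` with `i < j`. -/
noncomputable def JExt (n : ℕ) : Submodule (UExt n) (UExt n) :=
  Submodule.span (UExt n) {x | ∃ i j : Fin n, i < j ∧ x = toUExt n (E i j)}

/-- The normalizer `Norm J' = {v ∈ U'(g) : J' v ⊆ J'}`, a subring of `U'(g)`. -/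
noncomputable def normJExt (n : ℕ) : Subring (UExt n) where
  carrier := {v | ∀ x ∈ JExt n, x * v ∈ JExt n}
  mul_mem' {a b} ha hb x hx := by
    rw [← mul_assoc]
    exact hb _ (ha x hx)
  one_mem' x hx := by rwa [mul_one]
  add_mem' {a b} ha hb x hx := by
    rw [mul_add]
    exact Submodule.add_mem _ (ha x hx) (hb x hx)
  zero_mem' x hx := by
    rw [mul_zero]
    exact Submodule.zero_mem _
  neg_mem' {a} ha x hx := by
    rw [mul_neg]
    exact Submodule.neg_mem _ (ha x hx)

/-- `J'` as an ideal of `Norm J'` (it is contained in `Norm J'`, being a left ideal). -/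
noncomputable def jIdeal (n : ℕ) : Ideal (normJExt n) where
  carrier := {v | (v : UExt n) ∈ JExt n}
  add_mem' ha hb := Submodule.add_mem (JExt n) ha hb
  zero_mem' := Submodule.zero_mem (JExt n)
  smul_mem' c _ hx := Submodule.smul_mem (JExt n) (c : UExt n) hx

theorem mem_jIdeal {v : normJExt n} : v ∈ jIdeal n ↔ (v : UExt n) ∈ JExt n := Iff.rfl

/-- `J'` is a two-sided ideal of `Norm J'`. -/
instance instTwoSided (n : ℕ) : (jIdeal n).IsTwoSided where
  mul_mem_of_left {_} b ha := mem_jIdeal.2 (b.2 _ (mem_jIdeal.1 ha))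

/-- The Mickelsson-Zhelobenko algebra `Z(osp(1|2n), gl(n)) = (Norm J') / J'`. -/
abbrev Z (n : ℕ) : Type := normJExt n ⧸ jIdeal n

/-- The left `U'(g)`-module `M'(g, t) = U'(g) / J'`. -/
abbrev MExt (n : ℕ) : Type := UExt n ⧸ JExt n

/-- The inclusion of `Z(g, t) = (Norm J') / J'` into `M'(g, t) = U'(g) / J'`. -/
noncomputable def zToMExt (n : ℕ) : Z n →+ MExt n :=
  QuotientAddGroup.map (jIdeal n).toAddSubgroup (JExt n).toAddSubgroup (normJExt n).subtype.toAddMonoidHom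
    (fun _ h => mem_jIdeal.1 h)

theorem zToMExt_mk (v : normJExt n) :
    zToMExt n (Ideal.Quotient.mk (jIdeal n) v) = (JExt n).mkQ (v : UExt n) := rfl

theorem zToMExt_injective (n : ℕ) : Function.Injective (zToMExt n) := by
  rw [injective_iff_map_eq_zero]
  intro z hz
  obtain ⟨v, rfl⟩ := Ideal.Quotient.mk_surjective z
  rw [zToMExt_mk, Submodule.mkQ_apply, Submodule.Quotient.mk_eq_zero] at hz
  exact Ideal.Quotient.eq_zero_iff_mem.2 (mem_jIdeal.2 hz)

theorem weight_mul_rh {μ : Fin n → ℂ} {x : U n} (hx : HasWeight μ x) (q : Rh n) :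
    ∃ q' : Rh n, toUExt n x * rhToUExt n q = rhToUExt n q' * toUExt n x := by
  obtain ⟨f, g, hg, rfl⟩ := IsFractionRing.div_surjective (A := Uh n) q
  have hg0 := nonZeroDivisors.ne_zero hg
  have key : ∀ f : Uh n, toUExt n x * rhToUExt n (algebraMap _ _ f)
      = rhToUExt n (algebraMap _ _ (shift (-μ) f)) * toUExt n x := by
    intro f
    rw [rhToUExt_algebraMap, rhToUExt_algebraMap, ← map_mul, ← map_mul, hx, shift_neg_shift]
  have ne : ∀ f : Uh n, f ≠ 0 → algebraMap (Uh n) (Rh n) f ≠ 0 := fun f hf =>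
    (map_ne_zero_iff _ (IsFractionRing.injective (Uh n) (Rh n))).2 hf
  refine ⟨algebraMap _ _ (shift (-μ) f) / algebraMap _ _ (shift (-μ) g), ?_⟩
  have hg1 := ne _ hg0
  have hg2 := ne _ (shift_ne_zero (-μ) hg0)
  have inv : toUExt n x * rhToUExt n (algebraMap _ _ g)⁻¹
      = rhToUExt n (algebraMap _ _ (shift (-μ) g))⁻¹ * toUExt n x := by
    have := congrArg (fun y => rhToUExt n (algebraMap _ _ (shift (-μ) g))⁻¹ * y *
      rhToUExt n (algebraMap _ _ g)⁻¹) (key g)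
    simp only [← mul_assoc, ← map_mul, inv_mul_cancel₀ hg2, map_one, one_mul] at this
    rw [← this]
    simp only [mul_assoc, ← map_mul, mul_inv_cancel₀ hg1, map_one, mul_one]
  rw [div_eq_mul_inv, div_eq_mul_inv, map_mul, ← mul_assoc, key, mul_assoc, inv, ← mul_assoc,
    ← map_mul]

theorem hasWeight_E (i j : Fin n) : HasWeight (wt (-1) j + wt 1 i) (E i j : U n) :=
  (((hasWeight_B 1 i).mul (hasWeight_B (-1) j)).add
    (by rw [add_comm (wt (-1) j)]; exact (hasWeight_B (-1) j).mul (hasWeight_B 1 i))).smul _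

theorem rhToUExt_mem_normJExt (q : Rh n) : rhToUExt n q ∈ normJExt n := by
  intro x hx
  induction hx using Submodule.span_induction with
  | mem x hx =>
    obtain ⟨i, j, hij, rfl⟩ := hx
    obtain ⟨q', h⟩ := weight_mul_rh (hasWeight_E i j) q
    rw [h]
    exact Submodule.smul_mem _ _ (Submodule.subset_span ⟨i, j, hij, rfl⟩)
  | zero => simp
  | add x y _ _ hx hy => rw [add_mul]; exact Submodule.add_mem _ hx hy
  | smul a x _ hx => rw [smul_eq_mul, mul_assoc]; exact Submodule.smul_mem _ a hx

/-- The canonical homomorphism `R(h) → Z(g, t)`, through which `Z(g, t)` is an algebra over `R(h)`. -/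
noncomputable def rhToZ (n : ℕ) : Rh n →+* Z n :=
  (Ideal.Quotient.mk (jIdeal n)).comp ((rhToUExt n).codRestrict (normJExt n) rhToUExt_mem_normJExt)

/-- The element `h_i = E_ii - i + 1` of `R(h)`; here indices start from `0`, so that it reads
`E_ii - i`. -/
noncomputable def hShift (i : Fin n) : Rh n := algebraMap (Uh n) (Rh n) (X i) - ((i : ℕ) : Rh n)

open scoped Nat in
/-- The `k`-th term `((-1)^k / k!) E_ji^k E_ij^k (1 / (h_i - h_j + 1)_k)` of the formal series `p_ij`,
with `(x)_k = x (x + 1) ⋯ (x + k - 1)`. -/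
noncomputable def extremalTerm (i j : Fin n) (k : ℕ) : UExt n :=
  ((-1 : ℂ) ^ k / (k ! : ℂ)) • (toUExt n (E j i) ^ k * toUExt n (E i j) ^ k *
    rhToUExt n (1 / (ascPochhammer (Rh n) k).eval (hShift i - hShift j + 1)))

theorem exists_pow_E_mul {i j : Fin n} (hij : i < j) (r : U n) (m : ℕ) :
    ∃ N, ∃ r' : U n, E i j ^ N * r = r' * E i j ^ m := by
  revert m
  induction r using U_induction with
  | hs c => exact fun m => ⟨m, _, (Algebra.commutes _ _).symm⟩
  | hB ε l =>
    intro m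
    -- `ad E` squares to zero on the generators
    have hD : ⁅(E i j : U n), ⁅(E i j : U n), B ε l⁆⁆ = 0 := by
      have e₁ : ⁅(E i j : U n), B 1 i⁆ = 0 := by rw [E_lie_B]; simp [hij.ne']
      have e₂ : ⁅(E i j : U n), B (-1) j⁆ = 0 := by rw [E_lie_B]; simp [hij.ne]
      rw [Ring.lie_def, sub_eq_zero] at e₁ e₂
      rw [E_lie_B, Ring.lie_def, sub_eq_zero]
      simp only [mul_add, add_mul, mul_smul_comm, smul_mul_assoc, e₁, e₂]
    set D := ⁅(E i j : U n), B ε l⁆ with hDdef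
    have h1 : E i j * B ε l = B ε l * E i j + D := by rw [hDdef, Ring.lie_def]; abel
    have h2 : E i j * D = D * E i j := by rwa [Ring.lie_def, sub_eq_zero] at hD
    have h3 : ∀ k : ℕ, E i j ^ k * D = D * E i j ^ k := fun k =>
      ((show Commute (E i j) D from h2).pow_left k)
    have h4 : ∀ k : ℕ, E i j ^ (k + 1) * B ε l
        = (B ε l * E i j + ((k + 1 : ℕ) : U n) * D) * E i j ^ k := by
      intro k
      induction k with
      | zero => simp [h1]
      | succ k ih =>
        rw [pow_succ' _ (k + 1), mul_assoc, ih, ← mul_assoc, mul_add, ← mul_assoc, h1,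
          ← mul_assoc, ← Nat.cast_comm, mul_assoc _ (E i j) D, h2, pow_succ' _ k]
        push_cast
        noncomm_ring
    exact ⟨m + 1, _, h4 m⟩
  | hm x y hx hy =>
    intro m
    obtain ⟨N, y', h1⟩ := hy m
    obtain ⟨K, x', h2⟩ := hx N
    exact ⟨K, x' * y', by rw [← mul_assoc, h2, mul_assoc, h1, mul_assoc]⟩
  | ha x y hx hy =>
    intro m
    obtain ⟨N, y', h1⟩ := hy m
    obtain ⟨K, x', h2⟩ := hx m
    refine ⟨N + K, E i j ^ N * x' + E i j ^ K * y', ?_⟩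
    rw [mul_add, pow_add, mul_assoc, h2, ← pow_add, add_comm N K, pow_add, mul_assoc, h1, add_mul,
      mul_assoc, mul_assoc]

theorem pow_E_mul_rh (i j : Fin n) (k : ℕ) (q : Rh n) :
    ∃ q' : Rh n, toUExt n (E i j) ^ k * rhToUExt n q = rhToUExt n q' * toUExt n (E i j) ^ k := by
  induction k generalizing q with
  | zero => exact ⟨q, by simp⟩
  | succ k ih =>
    obtain ⟨q₁, h₁⟩ := weight_mul_rh (hasWeight_E i j) q
    obtain ⟨q₂, h₂⟩ := ih q₁
    exact ⟨q₂, by rw [pow_succ, mul_assoc, h₁, ← mul_assoc, h₂, mul_assoc]⟩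

theorem extremalTerm_smul_finite {i j : Fin n} (hij : i < j) (u : MExt n) :
    ∃ N, ∀ k, N ≤ k → extremalTerm i j k • u = 0 := by
  obtain ⟨x, rfl⟩ := (JExt n).mkQ_surjective u
  induction x using OreLocalization.ind with
  | _ r s =>
  obtain ⟨_, g, hg, rfl⟩ := s
  obtain ⟨N, r', hr⟩ := exists_pow_E_mul hij r 1
  have hx : (r /ₒ (⟨cartan n g, g, hg, rfl⟩ : denoms n) : UExt n)
      = rhToUExt n (algebraMap (Uh n) (Rh n) g)⁻¹ * toUExt n r := by
    have h₁ : toUExt n (cartan n g) * (r /ₒ (⟨cartan n g, g, hg, rfl⟩ : denoms n) : UExt n)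
        = toUExt n r := OreLocalization.smul_cancel (s := (⟨cartan n g, g, hg, rfl⟩ : denoms n))
    have hg0 : algebraMap (Uh n) (Rh n) g ≠ 0 :=
      (map_ne_zero_iff _ (IsFractionRing.injective (Uh n) (Rh n))).2 (nonZeroDivisors.ne_zero hg)
    rw [← h₁, ← rhToUExt_algebraMap, ← mul_assoc, ← map_mul, inv_mul_cancel₀ hg0, map_one, one_mul]
  refine ⟨N, fun k hk => ?_⟩
  obtain ⟨d, rfl⟩ := Nat.exists_eq_add_of_le' hk
  obtain ⟨q, hq⟩ := pow_E_mul_rh i j (d + N)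
    ((1 / (ascPochhammer (Rh n) (d + N)).eval (hShift i - hShift j + 1)) *
      (algebraMap (Uh n) (Rh n) g)⁻¹)
  rw [← map_smul, Submodule.mkQ_apply, Submodule.Quotient.mk_eq_zero, hx, smul_eq_mul,
    extremalTerm, smul_mul_assoc, Algebra.smul_def]
  refine Submodule.smul_mem _ (algebraMap ℂ (UExt n) _) ?_
  have he : toUExt n (E i j) ^ N * toUExt n r = toUExt n r' * toUExt n (E i j) := by
    rw [← map_pow, ← map_mul, hr, pow_one, map_mul]
  rw [mul_assoc, ← mul_assoc (rhToUExt n _), ← map_mul, mul_assoc, ← mul_assoc (_ ^ _) (rhToUExt n _),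
    hq, mul_assoc (rhToUExt n q), pow_add (toUExt n (E i j)), mul_assoc (_ ^ d) (_ ^ N), he]
  simp only [← mul_assoc]
  exact Submodule.smul_mem _ _ (Submodule.subset_span ⟨i, j, hij, rfl⟩)

/-- The action of the formal series `p_ij` on `M'(g, t)`. For `i < j` all but finitely many terms
of the sum are zero, by `extremalTerm_smul_finite`. -/
noncomputable def extremalFactor (i j : Fin n) (u : MExt n) : MExt n :=
  ∑ᶠ k : ℕ, extremalTerm i j k • u

/-- The positive roots in the normal order `(1,2), (1,3), (2,3), ..., (1,n), ..., (n-1,n)`. -/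
def normalOrder (n : ℕ) : List (Fin n × Fin n) :=
  (List.finRange n).flatMap fun j =>
    ((List.finRange n).filter fun i => i < j).map fun i => (i, j)

/-- The action on `M'(g, t)` of the extremal projector
`p = p_12 p_13 p_23 ⋯ p_1n ⋯ p_(n-1,n)` of `gl(n)`. -/
noncomputable def extremalProjector (n : ℕ) (u : MExt n) : MExt n :=
  (normalOrder n).foldr (fun a v => extremalFactor a.1 a.2 v) u

/-- The class in `M'(g, t)` of an element of `U(g)`. -/
noncomputable def mkMExt (n : ℕ) (x : U n) : MExt n := (JExt n).mkQ (toUExt n x)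

/-- The elements `p B_j^±` and, for `i ≤ j`, `p {B_i^±, B_j^±}` (equal signs) of `M'(g, t)`. -/
def generators (n : ℕ) : Set (MExt n) :=
  {u | ∃ (ε : ℤˣ) (j : Fin n), u = extremalProjector n (mkMExt n (B ε j))} ∪
  {u | ∃ (ε : ℤˣ) (i j : Fin n), i ≤ j ∧ u = extremalProjector n (mkMExt n (BB ε ε i j))}

end OspMZ

/-! # Generators of the Mickelsson-Zhelobenko algebra of `osp(1|2n)`, `gl(n)`

Write `M' = M'(g, t)`, `Z = Z(g, t)` and `p` for the extremal projector. Right multiplication makes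
`M'` a vector space over the field `R(h)`, on which `U'(g)` acts linearly from the left, and `M'` is
spanned by weight vectors. On a vector of weight `μ` the denominators of `p_ij` act by nonzero
scalars of `R(h)`, so that the identities for `p` become identities between finite sums in a
vector space.

The two properties of `p` that matter are `t⁺ p = 0` (`op_projector`) and `p t⁻ = 0`
(`projector_op`); for both it is enough to treat simple roots. In rank one they are the classical
computation for `sl(2)`. For `t⁺ p = 0` and adjacent indices `b < c`, disjoint factors commute, so
the columns of `b` and `c` in the normal order can be interleaved as a product of pairs
`p_ab p_ac` followed by `p_bc`; each pair preserves the kernel of `E_bc`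
(`op_extremalFactor_extremalFactor`) and `p_bc` maps into that kernel. For `p t⁻ = 0` and adjacent
`a < b`, each pair `p_ac p_bc` preserves the image of `E_ba` (`extremalFactor_extremalFactor_op`),
and `p_ab E_ba = 0`. Both statements about pairs follow from four commutation rules between an
operator and the series `∑ c_k f^k e^k`.

As `Z ⊆ M'` consists of the vectors killed by `t⁺`, the first property puts the image of `p` in `Z`,
and `p` is the identity on `Z`. So it remains to see that `p (w)` lies in the subring generated by
`R(h)` and the `p B_j^ε` for every word `w` in the `B_j^ε`, since such words span `M'` over `R(h)`.
This is an induction on the length of the word: for a letter `x` and a word `w`,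
`p (x) · p (w) = p (x · p (w))`, because right multiplication by an element of `Z` commutes with
`p`. Here `p (w) - w` lies in the subspace generated under `t⁻` by words of the same length as `w`
but of smaller depth (`projector_word_sub_mem`), and `p (x f u) = p ([x, f] u)` for `f` in `t⁻`,
where `[x, f]` is again a combination of letters. Hence `p (x w)` agrees with `p (x) · p (w)` up to
terms `p (x' w')` with `w'` of smaller depth, and induction on the depth applies. In particular the
elements `p B_j^ε` together with `R(h)` already generate `Z`. -/

namespace OspMZ

open MvPolynomial

variable {n : ℕ}

/-! ### The relations of `gl(n)` -/

theorem E_lie_B_pos (i j l : Fin n) : ⁅E i j, B 1 l⁆ = if j = l then (B 1 i : U n) else 0 := by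
  rw [E_lie_B]
  split_ifs <;> norm_num

theorem E_lie_B_neg (i j l : Fin n) :
    ⁅E i j, B (-1) l⁆ = -(if i = l then (B (-1) j : U n) else 0) := by
  rw [E_lie_B]
  split_ifs <;> norm_num

theorem E_lie_E (i j k l : Fin n) :
    ⁅E i j, E k l⁆ = (if j = k then (E i l : U n) else 0) - (if i = l then E k j else 0) := by
  have leib : ∀ a x y : U n, ⁅a, x * y⁆ = ⁅a, x⁆ * y + x * ⁅a, y⁆ := fun a x y => by
    simp only [Ring.lie_def]
    noncomm_ring
  have hs : ∀ (a x : U n) (c : ℂ), ⁅a, c • x⁆ = c • ⁅a, x⁆ := fun a x c => by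
    simp only [Ring.lie_def, mul_smul_comm, smul_mul_assoc, smul_sub]
  have hadd : ∀ a x y : U n, ⁅a, x + y⁆ = ⁅a, x⁆ + ⁅a, y⁆ := fun a x y => by
    simp only [Ring.lie_def]
    noncomm_ring
  have h : ∀ k l, (E k l : U n) = (1 / 2 : ℂ) • (B 1 k * B (-1) l + B (-1) l * B 1 k) :=
    fun _ _ => rfl
  rw [h k l, hs, hadd, leib, leib, E_lie_B_pos, E_lie_B_neg]
  split_ifs <;> simp only [h, mul_zero, zero_mul, mul_neg, neg_mul, smul_add, smul_neg, neg_zero,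
    add_zero, zero_add, sub_zero, zero_sub, smul_zero, neg_add_rev] <;> abel

/-! ### Rank one: the partial sums of the extremal projector of `sl(2)` -/

section RankOne

open Finset
open scoped Nat

variable {K V : Type*} [Field K] [AddCommGroup V] [Module K V]

/-- The coefficient `((-1)^k / k!) / (a)_k` of the extremal projector of `sl(2)`. -/
noncomputable def projCoeff (a : K) (k : ℕ) : K :=
  (-1) ^ k / (k ! : K) * ((ascPochhammer K k).eval a)⁻¹

@[simp] theorem projCoeff_zero (a : K) : projCoeff a 0 = 1 := by simp [projCoeff]

theorem projCoeff_succ [CharZero K] {a : K} {k : ℕ} (h : a + k ≠ 0) :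
    ((k : K) + 1) * projCoeff a (k + 1) = -(projCoeff a k / (a + k)) := by
  have h1 : (k : K) + 1 ≠ 0 := by exact_mod_cast k.succ_ne_zero
  have h2 : (k ! : K) ≠ 0 := by exact_mod_cast k.factorial_ne_zero
  rw [projCoeff, projCoeff, ascPochhammer_succ_eval, Nat.factorial_succ, mul_inv, pow_succ]
  push_cast
  field_simp

variable (e f : Module.End K V) (a : K)

/-- The partial sum `∑ c_k f^k e^k v` over `k < N` of the extremal projector, `c_k` being
`projCoeff a k`. -/
noncomputable def projSum (N : ℕ) (v : V) : V :=
  ∑ k ∈ range N, projCoeff a k • (f ^ k) ((e ^ k) v)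

/-- The partial sum `∑ (c_k / (a + k)) f^k e^(k+1) v`, proportional to the image under `e` of the
extremal projector. -/
noncomputable def raiseSum (N : ℕ) (v : V) : V :=
  ∑ k ∈ range N, (projCoeff a k / (a + k)) • (f ^ k) ((e ^ (k + 1)) v)

/-- The partial sum `∑ (c_k / (a + k)) f^(k+1) e^k v`, proportional to the extremal projector
applied to `f v`. -/
noncomputable def lowerSum (N : ℕ) (v : V) : V :=
  ∑ k ∈ range N, (projCoeff a k / (a + k)) • (f ^ (k + 1)) ((e ^ k) v)

variable {e f a}

theorem lowerSum_smul (N : ℕ) (c : K) (v : V) :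
    lowerSum e f a N (c • v) = c • lowerSum e f a N v := by
  simp only [lowerSum, map_smul, smul_sum, smul_comm c]

theorem projSum_neg (N : ℕ) (v : V) : projSum e f a N (-v) = -projSum e f a N v := by
  simp [projSum]

theorem projSum_add (N : ℕ) (v w : V) :
    projSum e f a N (v + w) = projSum e f a N v + projSum e f a N w := by
  simp [projSum, sum_add_distrib]

theorem apply_pow_of_weight {h : Module.End K V} (he : h * e = e * h + 2 * e) {v : V} {r : K}
    (hv : h v = r • v) (k : ℕ) : h ((e ^ k) v) = (r + 2 * k) • (e ^ k) v := by
  induction k with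
  | zero => simp [hv]
  | succ k ih =>
    have := LinearMap.congr_fun he ((e ^ k) v)
    simp only [Module.End.mul_apply, LinearMap.add_apply, ih, map_smul, two_mul] at this
    rw [pow_succ', Module.End.mul_apply, this]
    push_cast
    module

theorem pow_apply_lower {h : Module.End K V} (hef : e * f = f * e + h) (he : h * e = e * h + 2 * e)
    (k : ℕ) : ∀ {y : V} {r : K}, h y = r • y →
      (e ^ (k + 1)) (f y) = f ((e ^ (k + 1)) y) + (((k : K) + 1) * (r + k)) • (e ^ k) y := by
  have hef' : ∀ x, e (f x) = f (e x) + h x := LinearMap.congr_fun hef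
  induction k with
  | zero => intro y r hy; simp [hef', hy]
  | succ k ih =>
    intro y r hy
    have hy' : h (e y) = (r + 2) • e y := by
      simpa using apply_pow_of_weight he hy 1
    rw [pow_succ, Module.End.mul_apply, hef', map_add, ih hy', hy, map_smul,
      ← Module.End.mul_apply _ e y, ← pow_succ, ← Module.End.mul_apply _ e y, ← pow_succ]
    push_cast
    module

theorem apply_pow_lower {h : Module.End K V} (hef : e * f = f * e + h) (hf : h * f = f * h - 2 * f)
    (k : ℕ) : ∀ {x : V} {r : K}, h x = r • x →
      e ((f ^ (k + 1)) x) = (f ^ (k + 1)) (e x) + (((k : K) + 1) * (r - k)) • (f ^ k) x := by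
  have hef' : ∀ x, e (f x) = f (e x) + h x := LinearMap.congr_fun hef
  induction k with
  | zero => intro x r hx; simp [hef', hx]
  | succ k ih =>
    intro x r hx
    have hx' : h (f x) = (r - 2) • f x := by
      have := LinearMap.congr_fun hf x
      simp only [Module.End.mul_apply, LinearMap.sub_apply, hx, map_smul, two_mul,
        LinearMap.add_apply] at this
      rw [this]
      module
    rw [pow_succ, Module.End.mul_apply, ih hx', hef', map_add, hx, map_smul, Module.End.mul_apply,
      ← Module.End.mul_apply _ f x, ← pow_succ]
    push_cast
    module

variable [CharZero K]

/-- The image of the series under `e`. For `a = r + 2`, the parameter of a simple root, it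
vanishes. -/
theorem apply_projSum {h : Module.End K V} (hef : e * f = f * e + h) (he : h * e = e * h + 2 * e)
    (hf : h * f = f * h - 2 * f) (ha : ∀ k : ℕ, a + k ≠ 0) {v : V} {r : K} (hv : h v = r • v)
    {N : ℕ} (hN : (e ^ (N + 1)) v = 0) :
    e (projSum e f a (N + 1) v) = (a - r - 2) • raiseSum e f a N v := by
  have step : ∀ k : ℕ, e ((f ^ (k + 1)) ((e ^ (k + 1)) v)) = (f ^ (k + 1)) ((e ^ (k + 2)) v)
      + (((k : K) + 1) * (r + k + 2)) • (f ^ k) ((e ^ (k + 1)) v) := by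
    intro k
    rw [apply_pow_lower hef hf k (apply_pow_of_weight he hv (k + 1)), pow_succ' _ (k + 1),
      Module.End.mul_apply]
    push_cast
    congr 2
    ring
  rw [projSum, map_sum, sum_range_succ', raiseSum, smul_sum]
  simp only [map_smul, step, smul_add, sum_add_distrib]
  have e1 : ∑ k ∈ range N, projCoeff a (k + 1) • (f ^ (k + 1)) ((e ^ (k + 2)) v)
      + projCoeff a 0 • e ((f ^ 0) ((e ^ 0) v))
      = ∑ k ∈ range N, projCoeff a k • (f ^ k) ((e ^ (k + 1)) v) := by
    have := sum_range_succ' (fun k => projCoeff a k • (f ^ k) ((e ^ (k + 1)) v)) N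
    rw [sum_range_succ, hN, map_zero, smul_zero, add_zero] at this
    rw [this]
    simp
  rw [add_right_comm, e1, ← sum_add_distrib]
  refine sum_congr rfl fun k _ => ?_
  rw [smul_smul, smul_smul, ← add_smul, ← mul_assoc, mul_comm (projCoeff a (k + 1)),
    projCoeff_succ (ha k)]
  congr 1
  have := ha k
  field_simp
  ring

/-- The series applied to `f y`. For `a = r`, the parameter of a simple root (`f y` has weight
`r - 2`), it vanishes. -/
theorem projSum_apply_lower {h : Module.End K V} (hef : e * f = f * e + h)
    (he : h * e = e * h + 2 * e) (ha : ∀ k : ℕ, a + k ≠ 0) {y : V} {r : K} (hy : h y = r • y)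
    {N : ℕ} (hN : (e ^ N) y = 0) :
    projSum e f a (N + 1) (f y) = (a - r) • lowerSum e f a N y := by
  rw [projSum, sum_range_succ', lowerSum, smul_sum]
  simp only [pow_apply_lower hef he _ hy, map_add, map_smul, smul_add, sum_add_distrib]
  have hp : ∀ (k : ℕ) (x : V), (f ^ k) (f x) = (f ^ (k + 1)) x := fun k x => by
    rw [pow_succ, Module.End.mul_apply]
  have e1 : ∑ k ∈ range N, projCoeff a (k + 1) • (f ^ (k + 1)) (f ((e ^ (k + 1)) y))
      + projCoeff a 0 • (f ^ 0) ((e ^ 0) (f y))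
      = ∑ k ∈ range N, projCoeff a k • (f ^ (k + 1)) ((e ^ k) y) := by
    have := sum_range_succ' (fun k => projCoeff a k • (f ^ (k + 1)) ((e ^ k) y)) N
    rw [sum_range_succ, hN, map_zero, smul_zero, add_zero] at this
    rw [this]
    simp [hp]
  rw [add_right_comm, e1, ← sum_add_distrib]
  refine sum_congr rfl fun k _ => ?_
  rw [smul_smul, smul_smul, ← add_smul, ← mul_assoc, mul_comm (projCoeff a (k + 1)),
    projCoeff_succ (ha k)]
  congr 1
  have := ha k
  field_simp
  ring

/-- The commutation rule of the series with an operator `T` that commutes with `f` and satisfies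
`[e, T] = g`, where `g` commutes with `e`. -/
theorem apply_projSum_of_raise {T g : Module.End K V} (hT : T * e = e * T - g) (hg : Commute g e)
    (hf : Commute T f) (ha : ∀ k : ℕ, a + k ≠ 0) (w : V) (N : ℕ) :
    T (projSum e f a (N + 1) w) = projSum e f a (N + 1) (T w) + lowerSum e f a N (g w) := by
  have hpow : ∀ k : ℕ, T * e ^ (k + 1)
      = e ^ (k + 1) * T - ((k + 1 : ℕ) : Module.End K V) * (e ^ k * g) := by
    intro k
    induction k with
    | zero => simp [hT]
    | succ k ih =>
      rw [pow_succ, ← mul_assoc, ih, sub_mul, mul_assoc, hT, mul_assoc _ _ e, mul_assoc _ g e,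
        hg.eq, ← mul_assoc (e ^ k), ← pow_succ, mul_sub, ← mul_assoc, ← pow_succ]
      push_cast
      noncomm_ring
  have step : ∀ (k : ℕ) (x : V), T ((f ^ (k + 1)) ((e ^ (k + 1)) x))
      = (f ^ (k + 1)) ((e ^ (k + 1)) (T x))
      - ((k : K) + 1) • (f ^ (k + 1)) ((e ^ k) (g x)) := by
    intro k x
    have h1 := LinearMap.congr_fun (hf.pow_right (k + 1)).eq ((e ^ (k + 1)) x)
    have h2 := LinearMap.congr_fun (hpow k) x
    simp only [Module.End.mul_apply, LinearMap.sub_apply, Module.End.natCast_apply] at h1 h2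
    rw [h1, h2, map_sub, ← Nat.cast_smul_eq_nsmul K, map_smul]
    push_cast
    rfl
  rw [projSum, sum_range_succ', projSum, sum_range_succ', lowerSum, map_add, map_sum]
  simp only [map_smul, step, smul_sub, sum_sub_distrib, pow_zero, Module.End.one_apply, smul_smul]
  rw [sub_add_eq_add_sub, sub_eq_iff_eq_add, add_assoc, ← sum_add_distrib]
  simp only [← add_smul, mul_comm (projCoeff a (_ + 1)), projCoeff_succ (ha _)]
  simp

/-- The commutation rule of the series with an operator `T` that commutes with `e` and satisfies
`[T, f] = g`, where `g` commutes with `f`. -/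
theorem apply_projSum_of_lower {T g : Module.End K V} (hT : T * f = f * T + g) (hg : Commute g f)
    (he : Commute T e) (ha : ∀ k : ℕ, a + k ≠ 0) (v : V) (N : ℕ) :
    T (projSum e f a (N + 1) v) = projSum e f a (N + 1) (T v) - g (raiseSum e f a N v) := by
  have hpow : ∀ k : ℕ, T * f ^ (k + 1)
      = f ^ (k + 1) * T + ((k + 1 : ℕ) : Module.End K V) * (g * f ^ k) := by
    intro k
    induction k with
    | zero => simp [hT]
    | succ k ih =>
      rw [pow_succ, ← mul_assoc, ih, add_mul, mul_assoc, hT, mul_assoc _ _ f, mul_assoc g _ f,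
        ← pow_succ, mul_add, ← mul_assoc, ← pow_succ, ← (hg.pow_right (k + 1)).eq]
      push_cast
      noncomm_ring
  have step : ∀ (k : ℕ) (x : V), T ((f ^ (k + 1)) ((e ^ (k + 1)) x))
      = (f ^ (k + 1)) ((e ^ (k + 1)) (T x))
      + ((k : K) + 1) • g ((f ^ k) ((e ^ (k + 1)) x)) := by
    intro k x
    have h1 := LinearMap.congr_fun (he.pow_right (k + 1)).eq x
    have h2 := LinearMap.congr_fun (hpow k) ((e ^ (k + 1)) x)
    simp only [Module.End.mul_apply, LinearMap.add_apply, Module.End.natCast_apply] at h1 h2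
    rw [h2, h1, ← Nat.cast_smul_eq_nsmul K]
    push_cast
    rfl
  rw [projSum, sum_range_succ', projSum, sum_range_succ', raiseSum, map_add, map_sum, map_sum]
  simp only [map_smul, step, smul_add, sum_add_distrib, pow_zero, Module.End.one_apply, smul_smul]
  rw [add_right_comm, eq_sub_iff_add_eq, add_assoc, ← sum_add_distrib]
  simp only [← add_smul, mul_comm (projCoeff a (_ + 1)), projCoeff_succ (ha _)]
  simp

end RankOne

/-! ### `M'(g, t)` as a vector space over `R(h)` -/

/-- Right multiplication by an element of `Norm J'`, as an endomorphism of the left `U'(g)`-module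
`M'(g, t)`. -/
noncomputable def rightMul (v : normJExt n) : MExt n →ₗ[UExt n] MExt n :=
  (JExt n).mapQ (JExt n) (LinearMap.toSpanSingleton (UExt n) (UExt n) (v : UExt n))
    fun x hx => v.2 x hx

theorem rightMul_mk (v : normJExt n) (x : UExt n) :
    rightMul v ((JExt n).mkQ x) = (JExt n).mkQ (x * v) := rfl

theorem rightMul_zToMExt (v : normJExt n) (z : Z n) :
    rightMul v (zToMExt n z) = zToMExt n (z * Ideal.Quotient.mk (jIdeal n) v) := by
  obtain ⟨w, rfl⟩ := Ideal.Quotient.mk_surjective z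
  rw [← map_mul, zToMExt_mk, zToMExt_mk, rightMul_mk]
  rfl

/-- The action of `R(h)` on `M'(g, t)` by right multiplication. -/
noncomputable def rightScalar (n : ℕ) : Rh n →+* Module.End (UExt n) (MExt n) where
  toFun q := rightMul ⟨rhToUExt n q, rhToUExt_mem_normJExt q⟩
  map_one' := by
    refine LinearMap.ext fun u => ?_
    obtain ⟨x, rfl⟩ := (JExt n).mkQ_surjective u
    change (JExt n).mkQ (x * rhToUExt n 1) = (JExt n).mkQ x
    rw [map_one, mul_one]
  map_mul' p q := by
    refine LinearMap.ext fun u => ?_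
    obtain ⟨x, rfl⟩ := (JExt n).mkQ_surjective u
    change (JExt n).mkQ (x * rhToUExt n (p * q))
      = (JExt n).mkQ (x * rhToUExt n q * rhToUExt n p)
    rw [mul_comm p q, (rhToUExt n).map_mul, mul_assoc]
  map_zero' := by
    refine LinearMap.ext fun u => ?_
    obtain ⟨x, rfl⟩ := (JExt n).mkQ_surjective u
    change (JExt n).mkQ (x * rhToUExt n 0) = 0
    rw [(rhToUExt n).map_zero, mul_zero, map_zero]
  map_add' p q := by
    refine LinearMap.ext fun u => ?_
    obtain ⟨x, rfl⟩ := (JExt n).mkQ_surjective u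
    change (JExt n).mkQ (x * rhToUExt n (p + q))
      = (JExt n).mkQ (x * rhToUExt n p) + (JExt n).mkQ (x * rhToUExt n q)
    rw [(rhToUExt n).map_add, mul_add, map_add]

/-- The field `R(h)` acts on `M'(g, t)` by right multiplication, so that its action commutes with
the left action of `U'(g)`. -/
noncomputable instance instModuleRhMExt (n : ℕ) : Module (Rh n) (MExt n) :=
  Module.compHom (MExt n) (rightScalar n)

theorem rh_smul_mk (q : Rh n) (x : UExt n) :
    q • (JExt n).mkQ x = (JExt n).mkQ (x * rhToUExt n q) := rfl

instance instSMulCommMExt (n : ℕ) : SMulCommClass (UExt n) (Rh n) (MExt n) where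
  smul_comm x q u := ((rightScalar n q).map_smul x u).symm

instance instSMulCommMExt' (n : ℕ) : SMulCommClass (Rh n) (UExt n) (MExt n) :=
  SMulCommClass.symm _ _ _

/-- The left action of `E_ij` on `M'(g, t)`, an `R(h)`-linear operator. -/
noncomputable def op (i j : Fin n) : Module.End (Rh n) (MExt n) :=
  Module.toModuleEnd (Rh n) (MExt n) (toUExt n (E i j))

theorem op_apply (i j : Fin n) (u : MExt n) : op i j u = toUExt n (E i j) • u := rfl

theorem op_pow_apply (i j : Fin n) (k : ℕ) (u : MExt n) :
    (op i j ^ k) u = toUExt n (E i j) ^ k • u := by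
  rw [op, ← map_pow]
  rfl

theorem op_mul_op (i j k l : Fin n) :
    op i j * op k l = op k l * op i j
      + ((if j = k then op i l else 0) - (if i = l then op k j else 0)) := by
  have h := E_lie_E (n := n) i j k l
  rw [Ring.lie_def, sub_eq_iff_eq_add'] at h
  have h2 := congrArg (fun x => Module.toModuleEnd (Rh n) (MExt n) (toUExt n x)) h
  simp only [map_mul, map_add, map_sub, apply_ite (toUExt n), map_zero,
    apply_ite (Module.toModuleEnd (Rh n) (MExt n))] at h2
  exact h2

theorem op_commute {i j k l : Fin n} (h1 : j ≠ k) (h2 : i ≠ l) :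
    Commute (op i j) (op k l) := by
  have := op_mul_op i j k l
  rwa [if_neg h1, if_neg h2, sub_zero, add_zero] at this

/-- Weight vectors can be moved to the left of elements of `R(h)`; compare `weight_mul_rh`. -/
theorem rh_mul_weight {μ : Fin n → ℂ} {x : U n} (hx : HasWeight μ x) (q : Rh n) :
    ∃ q' : Rh n, rhToUExt n q * toUExt n x = toUExt n x * rhToUExt n q' := by
  obtain ⟨f, g, hg, rfl⟩ := IsFractionRing.div_surjective (A := Uh n) q
  have hg0 := nonZeroDivisors.ne_zero hg
  have key : ∀ f : Uh n, rhToUExt n (algebraMap _ _ f) * toUExt n x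
      = toUExt n x * rhToUExt n (algebraMap _ _ (shift μ f)) := by
    intro f
    rw [rhToUExt_algebraMap, rhToUExt_algebraMap, ← map_mul, ← map_mul, hx]
  have ne : ∀ f : Uh n, f ≠ 0 → algebraMap (Uh n) (Rh n) f ≠ 0 := fun f hf =>
    (map_ne_zero_iff _ (IsFractionRing.injective (Uh n) (Rh n))).2 hf
  have hg1 := ne _ hg0
  have hg2 := ne _ (shift_ne_zero μ hg0)
  have inv : rhToUExt n (algebraMap _ _ g)⁻¹ * toUExt n x
      = toUExt n x * rhToUExt n (algebraMap _ _ (shift μ g))⁻¹ := by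
    have := congrArg (fun y => rhToUExt n (algebraMap _ _ g)⁻¹ * y *
      rhToUExt n (algebraMap _ _ (shift μ g))⁻¹) (key g)
    simp only [← mul_assoc, ← map_mul, inv_mul_cancel₀ hg1, map_one, one_mul] at this
    simp only [mul_assoc, ← map_mul, mul_inv_cancel₀ hg2, map_one, mul_one] at this
    exact this.symm
  refine ⟨algebraMap _ _ (shift μ f) / algebraMap _ _ (shift μ g), ?_⟩
  rw [div_eq_mul_inv, div_eq_mul_inv, map_mul, mul_assoc, inv, ← mul_assoc, key, mul_assoc,
    ← map_mul]

theorem algebraMap_UExt (c : ℂ) : algebraMap ℂ (UExt n) c = toUExt n (algebraMap ℂ (U n) c) := rfl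

theorem toUExt_algebraMap (c : ℂ) :
    toUExt n (algebraMap ℂ (U n) c) = rhToUExt n (algebraMap ℂ (Rh n) c) := by
  rw [IsScalarTower.algebraMap_apply ℂ (Uh n) (Rh n), rhToUExt_algebraMap, AlgHom.commutes]

theorem algebraMap_smul_MExt (c : ℂ) (u : MExt n) :
    algebraMap ℂ (UExt n) c • u = algebraMap ℂ (Rh n) c • u := by
  obtain ⟨x, rfl⟩ := (JExt n).mkQ_surjective u
  rw [rh_smul_mk, ← map_smul, smul_eq_mul, Algebra.commutes, ← toUExt_algebraMap, algebraMap_UExt]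

/-! ### Words in the generators and weight vectors -/

/-- The product of the generators `B_j^ε` listed in `l`. -/
noncomputable def word (l : List (ℤˣ × Fin n)) : U n := (l.map fun p => B p.1 p.2).prod

@[simp] theorem word_nil : word ([] : List (ℤˣ × Fin n)) = 1 := rfl

@[simp] theorem word_cons (p : ℤˣ × Fin n) (l : List (ℤˣ × Fin n)) :
    word (p :: l) = B p.1 p.2 * word l := by simp [word]

theorem exists_hasWeight_word (l : List (ℤˣ × Fin n)) : ∃ μ, HasWeight μ (word l) := by
  induction l with
  | nil => exact ⟨0, by simpa using hasWeight_algebraMap (n := n) 1⟩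
  | cons p l ih =>
    obtain ⟨μ, h⟩ := ih
    exact ⟨_, word_cons p l ▸ (hasWeight_B p.1 p.2).mul h⟩

theorem span_word : Submodule.span ℂ (Set.range (word : List (ℤˣ × Fin n) → U n)) = ⊤ := by
  rw [eq_top_iff]
  rintro x -
  induction x using U_induction with
  | hs c =>
    rw [Algebra.algebraMap_eq_smul_one]
    exact Submodule.smul_mem _ _ (Submodule.subset_span ⟨[], rfl⟩)
  | hB ε j => exact Submodule.subset_span ⟨[(ε, j)], by simp⟩
  | ha x y hx hy => exact Submodule.add_mem _ hx hy
  | hm x y hx hy =>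
    have h := Submodule.mul_mem_mul hx hy
    rw [Submodule.span_mul_span] at h
    refine Submodule.span_mono ?_ h
    rintro _ ⟨_, ⟨l, rfl⟩, _, ⟨m, rfl⟩, rfl⟩
    exact ⟨l ++ m, by simp [word]⟩

theorem span_mkMExt_word :
    Submodule.span (Rh n) (Set.range fun l : List (ℤˣ × Fin n) => mkMExt n (word l)) = ⊤ := by
  rw [eq_top_iff]
  rintro u -
  obtain ⟨x, rfl⟩ := (JExt n).mkQ_surjective u
  induction x using OreLocalization.ind with
  | _ r s =>
  obtain ⟨_, g, hg, rfl⟩ := s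
  have hx : (r /ₒ (⟨cartan n g, g, hg, rfl⟩ : denoms n) : UExt n)
      = rhToUExt n (algebraMap (Uh n) (Rh n) g)⁻¹ * toUExt n r := by
    have h₁ : toUExt n (cartan n g) * (r /ₒ (⟨cartan n g, g, hg, rfl⟩ : denoms n) : UExt n)
        = toUExt n r := OreLocalization.smul_cancel (s := (⟨cartan n g, g, hg, rfl⟩ : denoms n))
    have hg0 : algebraMap (Uh n) (Rh n) g ≠ 0 :=
      (map_ne_zero_iff _ (IsFractionRing.injective (Uh n) (Rh n))).2 (nonZeroDivisors.ne_zero hg)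
    rw [← h₁, ← rhToUExt_algebraMap, ← mul_assoc, ← map_mul, inv_mul_cancel₀ hg0, map_one, one_mul]
  rw [hx]
  clear hx
  generalize (algebraMap (Uh n) (Rh n) g)⁻¹ = q
  have hr : r ∈ Submodule.span ℂ (Set.range (word : List (ℤˣ × Fin n) → U n)) :=
    span_word ▸ Submodule.mem_top
  induction hr using Submodule.span_induction generalizing q with
  | mem _ h =>
    obtain ⟨l, rfl⟩ := h
    obtain ⟨μ, hμ⟩ := exists_hasWeight_word l
    obtain ⟨q', h⟩ := rh_mul_weight hμ q
    rw [h, ← rh_smul_mk]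
    exact Submodule.smul_mem _ _ (Submodule.subset_span ⟨l, rfl⟩)
  | zero => simp
  | add x y _ _ hx hy =>
    rw [map_add, mul_add, map_add]
    exact Submodule.add_mem _ (hx q) (hy q)
  | smul c x _ hx =>
    rw [Algebra.smul_def, (toUExt n).map_mul, toUExt_algebraMap, ← mul_assoc,
      ← (rhToUExt n).map_mul]
    exact hx _

/-- The eigenvalue `E_ii + μ_i` in `R(h)` of the operator `E_ii` on vectors of weight `μ`. -/
noncomputable def wtScalar (μ : Fin n → ℂ) (i : Fin n) : Rh n :=
  algebraMap (Uh n) (Rh n) (X i + C (μ i))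

/-- The vectors `u` of `M'(g, t)` of weight `μ` for the adjoint action of `h`. In terms of the right
action of `R(h)` this reads `E_ii u = u (E_ii + μ_i)`. -/
noncomputable def mWeight (μ : Fin n → ℂ) : Submodule (Rh n) (MExt n) where
  carrier := {u | ∀ i, op i i u = wtScalar μ i • u}
  add_mem' hu hv i := by rw [map_add, hu i, hv i, smul_add]
  zero_mem' i := by simp
  smul_mem' q u hu i := by rw [map_smul, hu i, smul_comm]

theorem mkMExt_mem_mWeight {μ : Fin n → ℂ} {x : U n} (hx : HasWeight μ x) :
    mkMExt n x ∈ mWeight μ := by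
  intro i
  have h := hx (X i)
  rw [shift, aeval_X, cartan_X] at h
  rw [op_apply, mkMExt, rh_smul_mk, wtScalar, rhToUExt_algebraMap, ← map_mul, ← h, ← map_smul,
    smul_eq_mul, ← map_mul]

theorem iSup_mWeight : (⨆ μ, mWeight μ : Submodule (Rh n) (MExt n)) = ⊤ := by
  rw [eq_top_iff, ← span_mkMExt_word, Submodule.span_le]
  rintro _ ⟨l, rfl⟩
  obtain ⟨μ, hμ⟩ := exists_hasWeight_word l
  exact Submodule.mem_iSup_of_mem μ (mkMExt_mem_mWeight hμ)

theorem MExt_induction {P : MExt n → Prop} (h0 : P 0) (ha : ∀ u v, P u → P v → P (u + v))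
    (hw : ∀ μ, ∀ u ∈ mWeight μ, P u) (u : MExt n) : P u :=
  Submodule.iSup_induction (mWeight (n := n)) (motive := P) (iSup_mWeight ▸ Submodule.mem_top)
    hw h0 ha

theorem op_mem_mWeight {μ : Fin n → ℂ} {u : MExt n} (hu : u ∈ mWeight μ) (i j : Fin n) :
    op i j u ∈ mWeight (μ + (Pi.single i 1 - Pi.single j 1)) := by
  intro k
  have h := LinearMap.congr_fun (op_mul_op k k i j) u
  simp only [Module.End.mul_apply, LinearMap.add_apply, hu k, map_smul] at h
  rw [h, wtScalar, wtScalar]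
  by_cases h1 : k = i <;> by_cases h2 : k = j
  · subst h1 h2; simp
  · subst h1; simp [h2, add_smul, add_assoc]
  · subst h2; simp [h1, add_smul, add_assoc]
  · simp [h1, h2]

theorem exists_op_pow_eq_zero {i j : Fin n} (hij : i < j) (u : MExt n) :
    ∃ N, ∀ k, N ≤ k → (op i j ^ k) u = 0 := by
  suffices ∃ N, (op i j ^ N) u = 0 by
    obtain ⟨N, h⟩ := this
    refine ⟨N, fun k hk => ?_⟩
    rw [← Nat.sub_add_cancel hk, pow_add, Module.End.mul_apply, h, map_zero]
  have hu : u ∈ Submodule.span (Rh n) (Set.range fun l : List (ℤˣ × Fin n) => mkMExt n (word l)) :=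
    span_mkMExt_word ▸ Submodule.mem_top
  induction hu using Submodule.span_induction with
  | mem _ h =>
    obtain ⟨l, rfl⟩ := h
    obtain ⟨N, r', h⟩ := exists_pow_E_mul hij (word l) 1
    refine ⟨N, ?_⟩
    change (op i j ^ N) ((JExt n).mkQ (toUExt n (word l))) = 0
    rw [op_pow_apply, ← map_smul, Submodule.mkQ_apply, Submodule.Quotient.mk_eq_zero, smul_eq_mul,
      ← map_pow, ← map_mul, h, pow_one, map_mul]
    exact Submodule.smul_mem _ _ (Submodule.subset_span ⟨i, j, hij, rfl⟩)
  | zero => exact ⟨0, by simp⟩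
  | add x y _ _ hx hy =>
    obtain ⟨N, h1⟩ := hx
    obtain ⟨M, h2⟩ := hy
    refine ⟨N + M, ?_⟩
    have h3 : (op i j ^ (N + M)) x = 0 := by
      rw [add_comm, pow_add, Module.End.mul_apply, h1, map_zero]
    rw [map_add, h3, pow_add, Module.End.mul_apply, h2, map_zero, add_zero]
  | smul q x _ hx =>
    obtain ⟨N, h⟩ := hx
    exact ⟨N, by rw [map_smul, h, smul_zero]⟩

/-! ### The factors of the extremal projector on weight vectors -/

/-- The value on vectors of weight `μ` of the parameter `h_i - h_j + 1` of the series `p_ij`. -/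
noncomputable def projParam (μ : Fin n → ℂ) (i j : Fin n) : Rh n :=
  wtScalar μ i - wtScalar μ j + ((j : ℕ) : Rh n) - ((i : ℕ) : Rh n) + 1

theorem wtScalar_sub_add_ne_zero (μ : Fin n → ℂ) {i j : Fin n} (h : i ≠ j) (c : ℂ) :
    wtScalar μ i - wtScalar μ j + algebraMap ℂ (Rh n) c ≠ 0 := by
  rw [wtScalar, wtScalar, IsScalarTower.algebraMap_apply ℂ (Uh n) (Rh n), ← map_sub, ← map_add,
    map_ne_zero_iff _ (IsFractionRing.injective (Uh n) (Rh n))]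
  intro h0
  -- evaluate at a point where the polynomial takes the value `1`
  have := congrArg (eval (Pi.single i (1 - (μ i - μ j + c)))) h0
  simp only [map_add, map_sub, eval_X, eval_C, algebraMap_eq, Pi.single_eq_same,
    Pi.single_eq_of_ne' h, map_zero] at this
  exact one_ne_zero (α := ℂ) (by linear_combination this)

theorem projParam_add_ne_zero (μ : Fin n → ℂ) {i j : Fin n} (h : i ≠ j) (k : ℕ) :
    projParam μ i j + k ≠ 0 := by
  have := wtScalar_sub_add_ne_zero μ h ((j : ℕ) - (i : ℕ) + 1 + k)
  simp only [map_add, map_sub, map_natCast, map_one] at this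
  convert this using 1
  rw [projParam]
  ring

theorem hShift_sub_add_one (i j : Fin n) : hShift i - hShift j + 1 = projParam 0 i j := by
  simp only [hShift, projParam, wtScalar, Pi.zero_apply, map_zero, add_zero]
  ring

theorem projParam_eq_of_single {μ : Fin n → ℂ} {i j k l : Fin n} (hki : k ≠ i) (hkj : k ≠ j)
    (hli : l ≠ i) (hlj : l ≠ j) :
    projParam (μ + (Pi.single k 1 - Pi.single l 1)) i j = projParam μ i j := by
  simp [projParam, wtScalar, hki, hkj, hli, hlj]

theorem rhToUExt_hShift_smul {μ : Fin n → ℂ} {u : MExt n} (hu : u ∈ mWeight μ) (i : Fin n) :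
    rhToUExt n (hShift i) • u = (wtScalar μ i - ((i : ℕ) : Rh n)) • u := by
  rw [hShift, map_sub, map_natCast, rhToUExt_algebraMap, cartan_X, sub_smul, sub_smul, ← op_apply,
    hu i, Nat.cast_smul_eq_nsmul, Nat.cast_smul_eq_nsmul]

theorem rhToUExt_projParam_smul {μ : Fin n → ℂ} {u : MExt n} (hu : u ∈ mWeight μ) (i j : Fin n) :
    rhToUExt n (hShift i - hShift j + 1) • u = projParam μ i j • u := by
  rw [map_add, map_sub, map_one, add_smul, sub_smul, rhToUExt_hShift_smul hu,
    rhToUExt_hShift_smul hu, ← sub_smul, ← one_smul (Rh n) ((1 : UExt n) • u), one_smul (UExt n),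
    ← add_smul, projParam]
  congr 1
  ring

theorem rhToUExt_ascPochhammer_smul {x a : Rh n} {u : MExt n} (h : rhToUExt n x • u = a • u)
    (k : ℕ) :
    rhToUExt n ((ascPochhammer (Rh n) k).eval x) • u = (ascPochhammer (Rh n) k).eval a • u := by
  induction k with
  | zero => simp
  | succ k ih =>
    rw [ascPochhammer_succ_eval, ascPochhammer_succ_eval, map_mul, mul_smul, map_add, map_natCast,
      add_smul, h, Nat.cast_smul_eq_nsmul, ← Nat.cast_smul_eq_nsmul (Rh n), ← add_smul,
      smul_comm, ih, smul_smul, mul_comm]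

theorem rhToUExt_inv_smul {g a : Rh n} {u : MExt n} (hg : g ≠ 0) (ha : a ≠ 0)
    (h : rhToUExt n g • u = a • u) : rhToUExt n g⁻¹ • u = a⁻¹ • u := by
  have h1 : rhToUExt n g⁻¹ • rhToUExt n g • u = u := by
    rw [smul_smul, ← map_mul, inv_mul_cancel₀ hg, map_one, one_smul]
  rw [h, smul_comm] at h1
  rw [← smul_right_injective _ ha |>.eq_iff]
  rw [h1, smul_smul, mul_inv_cancel₀ ha, one_smul]

theorem ascPochhammer_eval_ne_zero {K : Type*} [Field K] {a : K} (ha : ∀ k : ℕ, a + k ≠ 0) (k : ℕ) :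
    (ascPochhammer K k).eval a ≠ 0 := by
  induction k with
  | zero => simp
  | succ k ih => rw [ascPochhammer_succ_eval]; exact mul_ne_zero ih (ha k)

theorem extremalTerm_smul {μ : Fin n → ℂ} {u : MExt n} (hu : u ∈ mWeight μ) {i j : Fin n}
    (hij : i ≠ j) (k : ℕ) : extremalTerm i j k • u
      = projCoeff (projParam μ i j) k • (op j i ^ k) ((op i j ^ k) u) := by
  rw [extremalTerm, Algebra.smul_def, mul_smul, algebraMap_smul_MExt, mul_smul, one_div,
    rhToUExt_inv_smul _ _ (rhToUExt_ascPochhammer_smul (rhToUExt_projParam_smul hu i j) k),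
    smul_comm, mul_smul, ← op_pow_apply, ← op_pow_apply, smul_smul, projCoeff]
  · simp
  · rw [hShift_sub_add_one]
    exact ascPochhammer_eval_ne_zero (projParam_add_ne_zero 0 hij) k
  · exact ascPochhammer_eval_ne_zero (projParam_add_ne_zero μ hij) k

theorem hasFiniteSupport_extremalTerm {i j : Fin n} (hij : i < j) (u : MExt n) :
    Function.HasFiniteSupport fun k => extremalTerm i j k • u := by
  obtain ⟨N, h⟩ := extremalTerm_smul_finite hij u
  refine (Set.finite_lt_nat N).subset fun k hk => ?_
  by_contra hk'
  exact hk (h k (not_lt.1 hk'))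

theorem extremalFactor_zero (i j : Fin n) : extremalFactor i j (0 : MExt n) = 0 := by
  simp [extremalFactor]

theorem extremalFactor_add {i j : Fin n} (hij : i < j) (u v : MExt n) :
    extremalFactor i j (u + v) = extremalFactor i j u + extremalFactor i j v := by
  simp only [extremalFactor, smul_add]
  exact finsum_add_distrib (hasFiniteSupport_extremalTerm hij u)
    (hasFiniteSupport_extremalTerm hij v)

/-- Each factor `p_ij` commutes with the endomorphisms of the left `U'(g)`-module `M'(g, t)`. -/
theorem map_extremalFactor {i j : Fin n} (hij : i < j) (φ : MExt n →ₗ[UExt n] MExt n) (u : MExt n) :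
    φ (extremalFactor i j u) = extremalFactor i j (φ u) := by
  rw [extremalFactor, extremalFactor]
  refine (φ.toAddMonoidHom.map_finsum (hasFiniteSupport_extremalTerm hij u)).trans ?_
  exact finsum_congr fun k => φ.map_smul _ _

theorem extremalFactor_smul {i j : Fin n} (hij : i < j) (q : Rh n) (u : MExt n) :
    extremalFactor i j (q • u) = q • extremalFactor i j u :=
  (map_extremalFactor hij (rightScalar n q) u).symm

theorem extremalFactor_eq_projSum {μ : Fin n → ℂ} {u : MExt n} (hu : u ∈ mWeight μ) {i j : Fin n}
    (hij : i < j) {N : ℕ} (hN : ∀ k, N ≤ k → (op i j ^ k) u = 0) :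
    extremalFactor i j u = projSum (op i j) (op j i) (projParam μ i j) N u := by
  rw [extremalFactor, finsum_eq_sum_of_support_subset (s := Finset.range N)]
  · exact Finset.sum_congr rfl fun k _ => extremalTerm_smul hu hij.ne k
  · intro k hk
    by_contra hk'
    refine hk ?_
    simp only [Finset.coe_range, Set.mem_Iio, not_lt] at hk'
    simp only [extremalTerm_smul hu hij.ne, hN k hk', map_zero, smul_zero]

theorem op_pow_op_pow_mem_mWeight {μ : Fin n → ℂ} {u : MExt n} (hu : u ∈ mWeight μ) (i j : Fin n)
    (k : ℕ) : (op j i ^ k) ((op i j ^ k) u) ∈ mWeight μ := by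
  have h : ∀ (i j : Fin n) (μ : Fin n → ℂ), ∀ u ∈ mWeight μ,
      (op i j ^ k) u ∈ mWeight (μ + (k : ℂ) • (Pi.single i 1 - Pi.single j 1)) := by
    intro i j
    induction k with
    | zero => intro μ u hu; simpa using hu
    | succ k ih =>
      intro μ u hu
      rw [pow_succ, Module.End.mul_apply]
      convert ih _ _ (op_mem_mWeight hu i j) using 2
      push_cast
      module
  have e : μ + (k : ℂ) • (Pi.single i 1 - Pi.single j 1)
      + (k : ℂ) • (Pi.single j 1 - Pi.single i 1) = μ := by module
  exact e ▸ h j i _ _ (h i j μ u hu)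

theorem extremalFactor_mem_mWeight {μ : Fin n → ℂ} {u : MExt n} (hu : u ∈ mWeight μ) {i j : Fin n}
    (hij : i < j) : extremalFactor i j u ∈ mWeight μ := by
  refine finsum_induction (· ∈ mWeight μ) (Submodule.zero_mem _)
    (fun x y hx hy => Submodule.add_mem _ hx hy) fun k => ?_
  rw [extremalTerm_smul hu hij.ne]
  exact Submodule.smul_mem _ _ (op_pow_op_pow_mem_mWeight hu i j k)

theorem raiseSum_mem_mWeight {μ : Fin n → ℂ} {u : MExt n} (hu : u ∈ mWeight μ) (i j : Fin n)
    (a : Rh n) (N : ℕ) :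
    raiseSum (op i j) (op j i) a N u ∈ mWeight (μ + (Pi.single i 1 - Pi.single j 1)) := by
  refine Submodule.sum_mem _ fun k _ => Submodule.smul_mem _ _ ?_
  rw [pow_succ, Module.End.mul_apply]
  exact op_pow_op_pow_mem_mWeight (op_mem_mWeight hu i j) i j k

/-! ### The `sl(2)`-triples of `gl(n)` -/

theorem op_mul_op_swap {i j : Fin n} : op i j * op j i = op j i * op i j + (op i i - op j j) := by
  simpa using op_mul_op i j j i

theorem op_weight_raise {i j : Fin n} (hij : i ≠ j) :
    (op i i - op j j) * op i j = op i j * (op i i - op j j) + 2 * op i j := by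
  have h1 := op_mul_op i i i j
  have h2 := op_mul_op j j i j
  simp only [if_true, hij, hij.symm, if_false] at h1 h2
  rw [sub_mul, h1, h2, mul_sub, two_mul]
  abel

theorem op_weight_lower {i j : Fin n} (hij : i ≠ j) :
    (op i i - op j j) * op j i = op j i * (op i i - op j j) - 2 * op j i := by
  have h1 := op_mul_op i i j i
  have h2 := op_mul_op j j j i
  simp only [if_true, hij, hij.symm, if_false] at h1 h2
  rw [sub_mul, h1, h2, mul_sub, two_mul]
  abel

theorem op_sub_apply {μ : Fin n → ℂ} {u : MExt n} (hu : u ∈ mWeight μ) (i j : Fin n) :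
    (op i i - op j j) u = (wtScalar μ i - wtScalar μ j) • u := by
  rw [LinearMap.sub_apply, hu i, hu j, sub_smul]

/-! ### Rank two -/

variable {μ : Fin n → ℂ} {u : MExt n}

theorem op_extremalFactor_self (hu : u ∈ mWeight μ) {b c : Fin n} (hbc : (c : ℕ) = b + 1) :
    op b c (extremalFactor b c u) = 0 := by
  have h : b < c := by rw [Fin.lt_def]; omega
  obtain ⟨N, hN⟩ := exists_op_pow_eq_zero h u
  rw [extremalFactor_eq_projSum hu h (N := N + 1) fun k hk => hN k (by omega),
    apply_projSum op_mul_op_swap (op_weight_raise h.ne) (op_weight_lower h.ne)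
      (projParam_add_ne_zero μ h.ne) (op_sub_apply hu b c) (hN _ (by omega))]
  convert zero_smul (Rh n) _ using 2
  rw [projParam, hbc]
  push_cast
  ring

theorem extremalFactor_op_self (hu : u ∈ mWeight μ) {b c : Fin n} (hbc : (c : ℕ) = b + 1) :
    extremalFactor b c (op c b u) = 0 := by
  have h : b < c := by rw [Fin.lt_def]; omega
  obtain ⟨N, hN⟩ := exists_op_pow_eq_zero h u
  obtain ⟨M, hM⟩ := exists_op_pow_eq_zero h (op c b u)
  have hv := op_mem_mWeight hu c b
  rw [extremalFactor_eq_projSum hv h (N := N + M + 1) fun k hk => hM k (by omega),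
    projSum_apply_lower op_mul_op_swap (op_weight_raise h.ne)
      (projParam_add_ne_zero _ h.ne) (op_sub_apply hu b c) (hN _ (by omega))]
  convert zero_smul (Rh n) _ using 2
  simp only [projParam, wtScalar, hbc, Pi.add_apply, Pi.sub_apply, Pi.single_eq_same,
    Pi.single_eq_of_ne h.ne, Pi.single_eq_of_ne h.ne', map_add, map_sub, map_one, map_zero]
  push_cast
  ring

/-- For adjacent `b < c` and `a < b` the product `p_ab p_ac` preserves the kernel of `E_bc`. -/
theorem op_extremalFactor_extremalFactor (hu : u ∈ mWeight μ) {a b c : Fin n} (hab : a < b)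
    (hbc : (c : ℕ) = b + 1) (h0 : op b c u = 0) :
    op b c (extremalFactor a b (extremalFactor a c u)) = 0 := by
  have hbc' : b < c := by rw [Fin.lt_def]; omega
  have hac := hab.trans hbc'
  obtain ⟨N, hN⟩ := exists_op_pow_eq_zero hac u
  set w := extremalFactor a c u with hw
  have hwμ : w ∈ mWeight μ := extremalFactor_mem_mWeight hu hac
  rw [extremalFactor_eq_projSum hu hac (N := N + 1) fun k hk => hN k (by omega)] at hw
  set Y := raiseSum (op a c) (op c a) (projParam μ a c) N u with hY
  have hYμ : Y ∈ mWeight (μ + (Pi.single a 1 - Pi.single c 1)) := raiseSum_mem_mWeight hu a c _ N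
  obtain ⟨M, hM⟩ := exists_op_pow_eq_zero hab Y
  obtain ⟨M', hM'⟩ := exists_op_pow_eq_zero hab w
  have hbw : op b c w = -op b a Y := by
    rw [hw, apply_projSum_of_lower (g := op b a) _ (op_commute hac.ne hab.ne')
      (op_commute hac.ne' hbc'.ne) (projParam_add_ne_zero μ hac.ne), h0, ← hY]
    · simp [projSum]
    · simpa [hab.ne'] using op_mul_op b c c a
  have haw : op a c w = (projParam μ a c - (wtScalar μ a - wtScalar μ c) - 2) • Y := by
    rw [hw, apply_projSum op_mul_op_swap (op_weight_raise hac.ne) (op_weight_lower hac.ne)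
      (projParam_add_ne_zero μ hac.ne) (op_sub_apply hu a c) (hN _ (by omega))]
  rw [extremalFactor_eq_projSum hwμ hab (N := M + M' + 1) fun k hk => hM' k (by omega),
    apply_projSum_of_raise (g := op a c) _ (op_commute hac.ne' hab.ne)
      (op_commute hbc'.ne' hab.ne') (projParam_add_ne_zero μ hab.ne), hbw, projSum_neg,
    projSum_apply_lower op_mul_op_swap (op_weight_raise hab.ne) (projParam_add_ne_zero μ hab.ne)
      (op_sub_apply hYμ a b) (hM _ (by omega)), haw, lowerSum_smul, neg_add_eq_zero]
  · congr 1
    simp only [projParam, wtScalar, hbc, Pi.add_apply, Pi.sub_apply, Pi.single_eq_same,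
      Pi.single_eq_of_ne hab.ne', Pi.single_eq_of_ne hac.ne, Pi.single_eq_of_ne hbc'.ne, map_add,
      map_sub, map_one, map_zero]
    push_cast
    ring
  · have := op_mul_op b c a b
    rw [if_neg hac.ne', if_pos rfl, zero_sub] at this
    rw [this, sub_eq_add_neg]

/-- For adjacent `a < b` and `b < c` the product `p_ac p_bc` preserves the image of `E_ba`. -/
theorem extremalFactor_extremalFactor_op (hu : u ∈ mWeight μ) {a b c : Fin n}
    (hab : (b : ℕ) = a + 1) (hbc : b < c) :
    ∃ v ∈ mWeight μ, extremalFactor a c (extremalFactor b c (op b a u)) = op b a v := by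
  have hab' : a < b := by rw [Fin.lt_def]; omega
  have hac := hab'.trans hbc
  set ν := μ + (Pi.single b 1 - Pi.single a 1) with hν
  have hv : op b a u ∈ mWeight ν := op_mem_mWeight hu b a
  obtain ⟨N, hN⟩ := exists_op_pow_eq_zero hbc u
  obtain ⟨N', hN'⟩ := exists_op_pow_eq_zero hbc (op b a u)
  set P := projSum (op b c) (op c b) (projParam ν b c) (N + N' + 1) u with hP
  set Y := raiseSum (op b c) (op c b) (projParam ν b c) (N + N') u with hY
  have hPμ : P ∈ mWeight μ := Submodule.sum_mem _ fun k _ =>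
    Submodule.smul_mem _ _ (op_pow_op_pow_mem_mWeight hu b c k)
  have hYμ : Y ∈ mWeight (μ + (Pi.single b 1 - Pi.single c 1)) := raiseSum_mem_mWeight hu b c _ _
  have h1 : extremalFactor b c (op b a u) = op b a P - op c a Y := by
    rw [extremalFactor_eq_projSum hv hbc (N := N + N' + 1) fun k hk => hN' k (by omega), hP, hY,
      apply_projSum_of_lower (g := -op c a) _ (op_commute hac.ne hbc.ne').neg_left
        (op_commute hab'.ne hbc.ne) (projParam_add_ne_zero ν hbc.ne), LinearMap.neg_apply]
    · abel
    · simpa [hac.ne] using op_mul_op b a c b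
  have h2 : op b c P = (projParam ν b c - (wtScalar μ b - wtScalar μ c) - 2) • Y :=
    apply_projSum op_mul_op_swap (op_weight_raise hbc.ne) (op_weight_lower hbc.ne)
      (projParam_add_ne_zero ν hbc.ne) (op_sub_apply hu b c) (hN _ (by omega))
  have hw : op b a P - op c a Y ∈ mWeight ν := by
    refine Submodule.sub_mem _ (op_mem_mWeight hPμ b a) ?_
    convert op_mem_mWeight hYμ c a using 2
    rw [hν]
    abel
  obtain ⟨M, hM⟩ := exists_op_pow_eq_zero hac (op b a P - op c a Y)
  obtain ⟨M', hM'⟩ := exists_op_pow_eq_zero hac Y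
  refine ⟨projSum (op a c) (op c a) (projParam ν a c) (M + M' + 1) P, Submodule.sum_mem _ fun k _ =>
    Submodule.smul_mem _ _ (op_pow_op_pow_mem_mWeight hPμ a c k), ?_⟩
  have h3 := apply_projSum_of_raise (T := op b a) (g := -op b c) (by
      simpa [hbc.ne] using op_mul_op b a a c) (op_commute hac.ne' hbc.ne).neg_left
    (op_commute hac.ne hab'.ne') (projParam_add_ne_zero ν hac.ne) P (M + M')
  rw [h1, extremalFactor_eq_projSum hw hac (N := M + M' + 1) fun k hk => hM k (by omega), h3,
    sub_eq_add_neg, projSum_add, projSum_neg, projSum_apply_lower op_mul_op_swap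
      (op_weight_raise hac.ne) (projParam_add_ne_zero ν hac.ne) (op_sub_apply hYμ a c)
      (hM' _ (by omega)), LinearMap.neg_apply, h2, ← neg_smul, ← neg_smul, lowerSum_smul,
    add_right_inj]
  congr 1
  simp only [hν, projParam, wtScalar, hab, Pi.add_apply, Pi.sub_apply, Pi.single_eq_same,
    Pi.single_eq_of_ne hab'.ne, Pi.single_eq_of_ne hab'.ne', Pi.single_eq_of_ne hac.ne,
    Pi.single_eq_of_ne hac.ne', Pi.single_eq_of_ne hbc.ne', map_add, map_sub, map_one, map_zero]
  push_cast
  ring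

/-! ### Products of factors -/

/-- The action on `M'(g, t)` of the product of the series `p_ij` over a list of pairs. -/
noncomputable def factorProd (L : List (Fin n × Fin n)) (u : MExt n) : MExt n :=
  L.foldr (fun a v => extremalFactor a.1 a.2 v) u

@[simp] theorem factorProd_nil (u : MExt n) : factorProd [] u = u := rfl

@[simp] theorem factorProd_cons (a : Fin n × Fin n) (L : List (Fin n × Fin n)) (u : MExt n) :
    factorProd (a :: L) u = extremalFactor a.1 a.2 (factorProd L u) := rfl

theorem factorProd_append (L L' : List (Fin n × Fin n)) (u : MExt n) :
    factorProd (L ++ L') u = factorProd L (factorProd L' u) := List.foldr_append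

/-- All pairs of the list are positive roots. -/
def Positive (L : List (Fin n × Fin n)) : Prop := ∀ a ∈ L, a.1 < a.2

theorem factorProd_mem_mWeight {μ : Fin n → ℂ} {u : MExt n} (hu : u ∈ mWeight μ)
    {L : List (Fin n × Fin n)} (hL : Positive L) : factorProd L u ∈ mWeight μ := by
  induction L with
  | nil => exact hu
  | cons a L ih =>
    exact extremalFactor_mem_mWeight (ih fun b hb => hL b (List.mem_cons_of_mem _ hb))
      (hL a List.mem_cons_self)

theorem map_factorProd {L : List (Fin n × Fin n)} (hL : Positive L)
    (φ : MExt n →ₗ[UExt n] MExt n) (u : MExt n) : φ (factorProd L u) = factorProd L (φ u) := by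
  induction L with
  | nil => rfl
  | cons a L ih =>
    rw [factorProd_cons, factorProd_cons, map_extremalFactor (hL a List.mem_cons_self),
      ih fun b hb => hL b (List.mem_cons_of_mem _ hb)]

theorem factorProd_add {L : List (Fin n × Fin n)} (hL : Positive L) (u v : MExt n) :
    factorProd L (u + v) = factorProd L u + factorProd L v := by
  induction L with
  | nil => rfl
  | cons a L ih =>
    rw [factorProd_cons, ih fun b hb => hL b (List.mem_cons_of_mem _ hb),
      extremalFactor_add (hL a List.mem_cons_self)]
    rfl

theorem factorProd_zero (L : List (Fin n × Fin n)) : factorProd L (0 : MExt n) = 0 := by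
  induction L with
  | nil => rfl
  | cons a L ih => rw [factorProd_cons, ih, extremalFactor_zero]

/-- The series `p_ij` and the operator `E_kl` commute when the index sets are disjoint. -/
theorem op_extremalFactor_comm {μ : Fin n → ℂ} {u : MExt n} (hu : u ∈ mWeight μ) {i j k l : Fin n}
    (hij : i < j) (hki : k ≠ i) (hkj : k ≠ j) (hli : l ≠ i) (hlj : l ≠ j) :
    op k l (extremalFactor i j u) = extremalFactor i j (op k l u) := by
  have h := op_mem_mWeight hu k l
  rw [extremalFactor, extremalFactor]
  refine ((op k l).toAddMonoidHom.map_finsum (hasFiniteSupport_extremalTerm hij u)).trans ?_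
  refine finsum_congr fun m => ?_
  have h1 := LinearMap.congr_fun ((op_commute hlj hki).pow_right m).eq ((op i j ^ m) u)
  have h2 := LinearMap.congr_fun ((op_commute hli hkj).pow_right m).eq u
  simp only [Module.End.mul_apply] at h1 h2
  rw [extremalTerm_smul h hij.ne, extremalTerm_smul hu hij.ne,
    projParam_eq_of_single hki hkj hli hlj, ← h2, ← h1]
  exact (op k l).map_smul _ _

theorem extremalFactor_comm {μ : Fin n → ℂ} {u : MExt n} (hu : u ∈ mWeight μ) {i j k l : Fin n}
    (hij : i < j) (hkl : k < l) (hki : k ≠ i) (hkj : k ≠ j) (hli : l ≠ i) (hlj : l ≠ j) :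
    extremalFactor i j (extremalFactor k l u) = extremalFactor k l (extremalFactor i j u) := by
  have hpow : ∀ (k l : Fin n), k ≠ i → k ≠ j → l ≠ i → l ≠ j → ∀ (m : ℕ) (ν : Fin n → ℂ),
      ∀ v ∈ mWeight ν,
        (op k l ^ m) (extremalFactor i j v) = extremalFactor i j ((op k l ^ m) v) := by
    intro k l hki hkj hli hlj m
    induction m with
    | zero => intro ν v _; rfl
    | succ m ih =>
      intro ν v hv
      rw [pow_succ, Module.End.mul_apply, op_extremalFactor_comm hv hij hki hkj hli hlj,
        ih _ _ (op_mem_mWeight hv k l)]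
      rfl
  have hmem : ∀ (m : ℕ) (ν : Fin n → ℂ), ∀ v ∈ mWeight ν, ∃ ν', (op k l ^ m) v ∈ mWeight ν' := by
    intro m
    induction m with
    | zero => exact fun ν v hv => ⟨ν, hv⟩
    | succ m ih =>
      intro ν v hv
      rw [pow_succ, Module.End.mul_apply]
      exact ih _ _ (op_mem_mWeight hv k l)
  obtain ⟨N, hN⟩ := exists_op_pow_eq_zero hkl u
  let φ : MExt n →ₗ[Rh n] MExt n :=
    { toFun := extremalFactor i j
      map_add' := extremalFactor_add hij
      map_smul' := extremalFactor_smul hij }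
  have hφ : ∀ v, φ v = extremalFactor i j v := fun _ => rfl
  have hu' := extremalFactor_mem_mWeight hu hij
  rw [extremalFactor_eq_projSum hu hkl hN, extremalFactor_eq_projSum hu' hkl (N := N), ← hφ,
    projSum, projSum, map_sum]
  · refine Finset.sum_congr rfl fun m _ => ?_
    obtain ⟨ν, hν⟩ := hmem m _ u hu
    rw [map_smul, hφ, ← hpow l k hli hlj hki hkj m ν _ hν, ← hpow k l hki hkj hli hlj m _ u hu]
  · intro m hm
    rw [hpow k l hki hkj hli hlj m _ u hu, hN m hm, extremalFactor_zero]

/-! ### The normal order -/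

/-- The indices less than `k`, in increasing order. -/
def initial (n k : ℕ) : List (Fin n) := (List.finRange n).filter fun i => i.val < k

theorem mem_initial {k : ℕ} {i : Fin n} : i ∈ initial n k ↔ i.val < k := by simp [initial]

theorem map_val_initial {k : ℕ} (hk : k ≤ n) : (initial n k).map Fin.val = List.range k := by
  have h : (initial n k).map Fin.val = (List.range n).filter fun i => i < k := by
    rw [← List.map_coe_finRange_eq_range, List.filter_map]
    rfl
  rw [h, ← Nat.sub_add_cancel hk, Nat.add_comm, List.range_add, List.filter_append,
    List.filter_eq_self.2 (by simp), List.filter_eq_nil_iff.2 (by simp), List.append_nil]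

theorem initial_succ {k : ℕ} (hk : k < n) : initial n (k + 1) = initial n k ++ [⟨k, hk⟩] := by
  refine List.map_injective_iff.2 Fin.val_injective ?_
  rw [List.map_append, map_val_initial hk, map_val_initial hk.le, List.range_succ]
  rfl

theorem nodup_initial (k : ℕ) : (initial n k).Nodup := (List.nodup_finRange n).filter _

/-- The positive roots `(i, c)` with `i < k`. -/
def column (k : ℕ) (c : Fin n) : List (Fin n × Fin n) := (initial n k).map fun i => (i, c)

theorem column_succ {k : ℕ} (hk : k < n) (c : Fin n) :
    column (k + 1) c = column k c ++ [(⟨k, hk⟩, c)] := by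
  rw [column, initial_succ hk, List.map_append]
  rfl

theorem positive_column {k : ℕ} {c : Fin n} (h : k ≤ c) : Positive (column k c) := by
  intro a ha
  obtain ⟨i, hi, rfl⟩ := List.mem_map.1 ha
  exact Fin.lt_def.2 ((mem_initial.1 hi).trans_le h)

/-- The part of the normal order that involves only indices less than `k`. -/
def orderUpTo (n k : ℕ) : List (Fin n × Fin n) :=
  (initial n k).flatMap fun c : Fin n => column c.val c

theorem orderUpTo_succ {k : ℕ} (hk : k < n) :
    orderUpTo n (k + 1) = orderUpTo n k ++ column k ⟨k, hk⟩ := by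
  rw [orderUpTo, initial_succ hk, List.flatMap_append]
  simp [orderUpTo]

theorem positive_orderUpTo (k : ℕ) : Positive (orderUpTo n k) := by
  intro a ha
  obtain ⟨c, _, h⟩ := List.mem_flatMap.1 ha
  exact positive_column le_rfl a h

theorem lt_of_mem_orderUpTo {k : ℕ} {a : Fin n × Fin n} (ha : a ∈ orderUpTo n k) :
    a.1.val < k ∧ a.2.val < k := by
  have h1 := positive_orderUpTo k a ha
  obtain ⟨c, hc, h⟩ := List.mem_flatMap.1 ha
  obtain ⟨i, _, rfl⟩ := List.mem_map.1 h
  have h2 := mem_initial.1 hc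
  exact ⟨(Fin.lt_def.1 h1).trans h2, h2⟩

theorem orderUpTo_self : orderUpTo n n = normalOrder n := by
  have : initial n n = List.finRange n := by simp [initial]
  rw [orderUpTo, this]
  rfl

theorem positive_normalOrder : Positive (normalOrder n) := orderUpTo_self ▸ positive_orderUpTo n

/-! ### The extremal projector annihilates `t⁺` and `t⁻` -/

theorem op_factorProd_comm {μ : Fin n → ℂ} {u : MExt n} (hu : u ∈ mWeight μ) {k l : Fin n}
    {L : List (Fin n × Fin n)} (hL : Positive L)
    (h : ∀ a ∈ L, k ≠ a.1 ∧ k ≠ a.2 ∧ l ≠ a.1 ∧ l ≠ a.2) :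
    op k l (factorProd L u) = factorProd L (op k l u) := by
  induction L with
  | nil => rfl
  | cons a L ih =>
    have hL' : Positive L := fun b hb => hL b (List.mem_cons_of_mem _ hb)
    obtain ⟨h1, h2, h3, h4⟩ := h a List.mem_cons_self
    rw [factorProd_cons, op_extremalFactor_comm (factorProd_mem_mWeight hu hL')
      (hL a List.mem_cons_self) h1 h2 h3 h4, ih hL' fun b hb => h b (List.mem_cons_of_mem _ hb)]
    rfl

/-- Commuting factors with disjoint indices, two adjacent columns can be interleaved, so that their
product preserves the kernel of `E_bc`. -/
theorem op_column_column {μ : Fin n → ℂ} {b c : Fin n} (hbc : (c : ℕ) = b + 1) :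
    ∀ l : List (Fin n), l.Nodup → (∀ i ∈ l, i < b) → ∀ u ∈ mWeight μ, op b c u = 0 →
      op b c (factorProd (l.map fun i => (i, b)) (factorProd (l.map fun i => (i, c)) u)) = 0 := by
  have hbc' : b < c := by rw [Fin.lt_def]; omega
  have pos : ∀ (l : List (Fin n)) (d : Fin n), (∀ i ∈ l, i < d) →
      Positive (l.map fun i => (i, d)) := by
    intro l d h a ha
    obtain ⟨i, hi, rfl⟩ := List.mem_map.1 ha
    exact h i hi
  have comm : ∀ (i : Fin n) (l : List (Fin n)), i ∉ l → i < b → (∀ j ∈ l, j < b) →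
      ∀ v ∈ mWeight μ, factorProd (l.map fun j => (j, b)) (extremalFactor i c v)
        = extremalFactor i c (factorProd (l.map fun j => (j, b)) v) := by
    intro i l hil hi hl v hv
    induction l with
    | nil => rfl
    | cons j l ih =>
      have hj := hl j List.mem_cons_self
      have hl' : ∀ j ∈ l, j < b := fun j hj => hl j (List.mem_cons_of_mem _ hj)
      rw [List.map_cons, factorProd_cons, factorProd_cons,
        ih (fun h => hil (List.mem_cons_of_mem _ h)) hl']
      exact extremalFactor_comm (factorProd_mem_mWeight hv (pos l b hl')) hj (hi.trans hbc')
        (fun h => hil (h ▸ List.mem_cons_self)) hi.ne (hj.trans hbc').ne' hbc'.ne'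
  intro l
  induction l with
  | nil => exact fun _ _ u _ h => h
  | cons i l ih =>
    intro hnd hl u hu h0
    obtain ⟨hil, hnd'⟩ := List.nodup_cons.1 hnd
    have hi := hl i List.mem_cons_self
    have hl' : ∀ j ∈ l, j < b := fun j hj => hl j (List.mem_cons_of_mem _ hj)
    have hm := factorProd_mem_mWeight hu (pos l c fun j hj => (hl' j hj).trans hbc')
    simp only [List.map_cons, factorProd_cons]
    rw [comm i l hil hi hl' _ hm]
    exact op_extremalFactor_extremalFactor (factorProd_mem_mWeight hm (pos l b hl')) hi hbc
      (ih hnd' hl' u hu h0)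

/-- `E_bc p = 0` for adjacent `b < c`, where `p` is the extremal projector of `gl(k)`. -/
theorem op_simple_factorProd {μ : Fin n → ℂ} {k : ℕ} (hk : k ≤ n) :
    ∀ {b c : Fin n}, (c : ℕ) = b + 1 → c.val < k → ∀ u ∈ mWeight μ,
      op b c (factorProd (orderUpTo n k) u) = 0 := by
  induction k with
  | zero => exact fun _ h => absurd h (Nat.not_lt_zero _)
  | succ k ih =>
    intro b c hbc hck u hu
    rw [orderUpTo_succ hk, factorProd_append]
    rcases Nat.lt_succ_iff_lt_or_eq.1 hck with h | h
    · exact ih (Nat.le_of_succ_le hk) hbc h _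
        (factorProd_mem_mWeight hu (positive_column le_rfl))
    · -- here `c` is the last index, and `E_bc` commutes with all factors up to the column of `b`
      have hc : (⟨k, hk⟩ : Fin n) = c := Fin.ext h.symm
      have hkb : k = b.val + 1 := h.symm.trans hbc
      have hbc' : b < c := by rw [Fin.lt_def]; omega
      subst hkb
      rw [hc, column_succ b.2, factorProd_append, orderUpTo_succ b.2, factorProd_append]
      set v := factorProd [(⟨b, b.2⟩, c)] u with hv
      have hvμ : v ∈ mWeight μ := extremalFactor_mem_mWeight hu hbc'
      have h0 : op b c v = 0 := op_extremalFactor_self hu hbc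
      have key := op_column_column hbc (initial n b) (nodup_initial _)
        (fun i hi => Fin.lt_def.2 (mem_initial.1 hi)) v hvμ h0
      have hm : factorProd (column b ⟨b, b.2⟩) (factorProd (column b c) v) ∈ mWeight μ :=
        factorProd_mem_mWeight (factorProd_mem_mWeight hvμ (positive_column (by omega)))
          (positive_column le_rfl)
      rw [op_factorProd_comm hm (positive_orderUpTo _)]
      · change factorProd _ (op b c (factorProd ((initial n b).map fun i => (i, b))
          (factorProd ((initial n b).map fun i => (i, c)) v))) = 0
        rw [key, factorProd_zero]
      · intro a ha
        obtain ⟨h1, h2⟩ := lt_of_mem_orderUpTo ha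
        refine ⟨?_, ?_, ?_, ?_⟩ <;> rintro rfl <;> omega

/-- For adjacent `a < b` a column that contains both `a` and `b` preserves the image of `E_ba`: the
pair of factors at `a`, `b` does, and `E_ba` commutes with the others. -/
theorem factorProd_column_op {μ : Fin n → ℂ} {a b c : Fin n} (hab : (b : ℕ) = a + 1) (hbc : b < c)
    {k : ℕ} (hbk : b.val < k) (hkc : k ≤ c) : ∀ u ∈ mWeight μ,
      ∃ v ∈ mWeight μ, factorProd (column k c) (op b a u) = op b a v := by
  have hb := Fin.lt_def.1 hbc
  have hc := c.2
  induction k, (show b.val + 1 ≤ k from hbk) using Nat.le_induction with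
  | base =>
    intro u hu
    obtain ⟨v, hv, h⟩ := extremalFactor_extremalFactor_op hu hab hbc
    have e : column (b.val + 1) c = column a c ++ [(a, c), (b, c)] := by
      have h' : column b.val c = column a c ++ [(a, c)] := by rw [hab, column_succ a.2]
      rw [column_succ b.2, h', List.append_assoc]
      rfl
    refine ⟨factorProd (column a c) v,
      factorProd_mem_mWeight hv (positive_column (by omega)), ?_⟩
    rw [e, factorProd_append, factorProd_cons, factorProd_cons, factorProd_nil, h,
      op_factorProd_comm hv (positive_column (by omega))]
    intro p hp
    obtain ⟨i, hi, rfl⟩ := List.mem_map.1 hp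
    have := mem_initial.1 hi
    refine ⟨?_, ?_, ?_, ?_⟩ <;> rintro rfl <;> omega
  | succ k hk ih =>
    intro u hu
    have hkn : k < n := by omega
    have hlt : (⟨k, hkn⟩ : Fin n) < c := Fin.lt_def.2 hkc
    rw [column_succ hkn, factorProd_append, factorProd_cons, factorProd_nil]
    rw [← op_extremalFactor_comm hu hlt]
    · exact ih (by omega) (by omega) _ (extremalFactor_mem_mWeight hu hlt)
    all_goals rintro rfl; first | omega | (simp only at *; omega)

/-- `p E_ba = 0` for adjacent `a < b`, where `p` is the extremal projector of `gl(k)`. -/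
theorem factorProd_op_simple {μ : Fin n → ℂ} {k : ℕ} (hk : k ≤ n) :
    ∀ {a b : Fin n}, (b : ℕ) = a + 1 → b.val < k → ∀ u ∈ mWeight μ,
      factorProd (orderUpTo n k) (op b a u) = 0 := by
  induction k with
  | zero => exact fun _ h => absurd h (Nat.not_lt_zero _)
  | succ k ih =>
    intro a b hab hbk u hu
    rw [orderUpTo_succ hk, factorProd_append]
    rcases Nat.lt_succ_iff_lt_or_eq.1 hbk with h | h
    · obtain ⟨v, hv, e⟩ := factorProd_column_op hab (c := ⟨k, hk⟩) h h le_rfl u hu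
      rw [e]
      exact ih (Nat.le_of_succ_le hk) hab h v hv
    · have hb : (⟨k, hk⟩ : Fin n) = b := Fin.ext h.symm
      have hka : k = a.val + 1 := h.symm.trans hab
      subst hka
      rw [hb, column_succ a.2, factorProd_append, factorProd_cons, factorProd_nil,
        extremalFactor_op_self hu hab, factorProd_zero, factorProd_zero]

/-- The extremal projector, as an `R(h)`-linear operator. -/
noncomputable def projector (n : ℕ) : Module.End (Rh n) (MExt n) where
  toFun := extremalProjector n
  map_add' := factorProd_add positive_normalOrder
  map_smul' q u := (map_factorProd positive_normalOrder (rightScalar n q) u).symm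

theorem projector_eq_factorProd (u : MExt n) : projector n u = factorProd (orderUpTo n n) u := by
  rw [orderUpTo_self]
  rfl

theorem map_projector (φ : MExt n →ₗ[UExt n] MExt n) (u : MExt n) :
    φ (projector n u) = projector n (φ u) := map_factorProd positive_normalOrder φ u

theorem op_simple_projector {b c : Fin n} (hbc : (c : ℕ) = b + 1) (u : MExt n) :
    op b c (projector n u) = 0 := by
  induction u using MExt_induction with
  | h0 => simp
  | ha u v hu hv => rw [map_add, map_add, hu, hv, add_zero]
  | hw μ u hu =>
    rw [projector_eq_factorProd]
    exact op_simple_factorProd le_rfl hbc c.2 u hu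

theorem projector_op_simple {a b : Fin n} (hab : (b : ℕ) = a + 1) (u : MExt n) :
    projector n (op b a u) = 0 := by
  induction u using MExt_induction with
  | h0 => simp
  | ha u v hu hv => rw [map_add, map_add, hu, hv, add_zero]
  | hw μ u hu =>
    rw [projector_eq_factorProd]
    exact factorProd_op_simple le_rfl hab b.2 u hu

/-- `t⁺ p = 0`. -/
theorem op_projector {i j : Fin n} (hij : i < j) (u : MExt n) : op i j (projector n u) = 0 := by
  have hj := j.2
  obtain ⟨d, hd⟩ := Nat.exists_eq_add_of_lt (Fin.lt_def.1 hij)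
  induction d generalizing j with
  | zero => exact op_simple_projector (by omega) u
  | succ d ih =>
    have hk : i.val + d + 1 < n := by omega
    have h := LinearMap.congr_fun (op_mul_op i ⟨_, hk⟩ ⟨_, hk⟩ j) (projector n u)
    rw [if_pos rfl, if_neg hij.ne, sub_zero] at h
    simp only [Module.End.mul_apply, LinearMap.add_apply] at h
    rw [ih (j := ⟨_, hk⟩) (Fin.lt_def.2 (by simp only; omega)) hk rfl,
      op_simple_projector (b := ⟨_, hk⟩) (by simp only; omega), map_zero, map_zero, zero_add] at h
    exact h.symm

/-- `p t⁻ = 0`. -/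
theorem projector_op {i j : Fin n} (hij : i < j) (u : MExt n) : projector n (op j i u) = 0 := by
  have hj := j.2
  obtain ⟨d, hd⟩ := Nat.exists_eq_add_of_lt (Fin.lt_def.1 hij)
  induction d generalizing j u with
  | zero => exact projector_op_simple (by omega) u
  | succ d ih =>
    have hk : i.val + d + 1 < n := by omega
    have h := LinearMap.congr_fun (op_mul_op j ⟨_, hk⟩ ⟨_, hk⟩ i) u
    rw [if_pos rfl, if_neg hij.ne', sub_zero] at h
    simp only [Module.End.mul_apply, LinearMap.add_apply] at h
    have h := congrArg (projector n) h
    rw [map_add, ih (j := ⟨_, hk⟩) (Fin.lt_def.2 (by simp only; omega)) _ hk rfl,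
      projector_op_simple (a := ⟨_, hk⟩) (by simp only; omega), zero_add] at h
    exact h.symm

/-! ### The space `Z(g, t)` inside `M'(g, t)` -/

theorem op_zToMExt {i j : Fin n} (hij : i < j) (z : Z n) : op i j (zToMExt n z) = 0 := by
  obtain ⟨v, rfl⟩ := Ideal.Quotient.mk_surjective z
  rw [zToMExt_mk, op_apply, ← map_smul, Submodule.mkQ_apply, Submodule.Quotient.mk_eq_zero]
  exact v.2 _ (Submodule.subset_span ⟨i, j, hij, rfl⟩)

theorem mem_range_zToMExt {u : MExt n} (h : ∀ i j : Fin n, i < j → op i j u = 0) :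
    u ∈ Set.range (zToMExt n) := by
  obtain ⟨x, rfl⟩ := (JExt n).mkQ_surjective u
  have hx : x ∈ normJExt n := by
    intro y hy
    induction hy using Submodule.span_induction with
    | mem y hy =>
      obtain ⟨i, j, hij, rfl⟩ := hy
      have := h i j hij
      rwa [op_apply, ← map_smul, Submodule.mkQ_apply, Submodule.Quotient.mk_eq_zero] at this
    | zero => simp
    | add y z _ _ hy hz => rw [add_mul]; exact Submodule.add_mem _ hy hz
    | smul a y _ hy => rw [smul_eq_mul, mul_assoc]; exact Submodule.smul_mem _ a hy
  exact ⟨Ideal.Quotient.mk (jIdeal n) ⟨x, hx⟩, rfl⟩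

theorem projector_mem_range (u : MExt n) : projector n u ∈ Set.range (zToMExt n) :=
  mem_range_zToMExt fun _ _ hij => op_projector hij u

theorem extremalFactor_eq_self {i j : Fin n} {u : MExt n} (h : op i j u = 0) :
    extremalFactor i j u = u := by
  rw [extremalFactor, finsum_eq_single _ 0]
  · simp [extremalTerm]
  · intro k hk
    obtain ⟨m, rfl⟩ := Nat.exists_eq_succ_of_ne_zero hk
    obtain ⟨q, hq⟩ := pow_E_mul_rh i j (m + 1)
      (1 / (ascPochhammer (Rh n) (m + 1)).eval (hShift i - hShift j + 1))
    rw [extremalTerm, mul_assoc, hq, pow_succ (toUExt n (E i j)), Algebra.smul_def]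
    simp only [mul_smul]
    rw [← op_apply, h]
    simp only [smul_zero]

theorem projector_zToMExt (z : Z n) : projector n (zToMExt n z) = zToMExt n z := by
  change factorProd (normalOrder n) _ = _
  have hL := positive_normalOrder (n := n)
  generalize normalOrder n = L at hL ⊢
  induction L with
  | nil => rfl
  | cons a L ih =>
    rw [factorProd_cons, ih fun b hb => hL b (List.mem_cons_of_mem _ hb),
      extremalFactor_eq_self (op_zToMExt (hL a List.mem_cons_self) z)]

/-- The image in `M'(g, t)` of a subring of `Z(g, t)` that contains `R(h)`, an `R(h)`-subspace. -/
noncomputable def subringImage (S : Subring (Z n)) (hS : ∀ q, rhToZ n q ∈ S) :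
    Submodule (Rh n) (MExt n) where
  carrier := zToMExt n '' S
  add_mem' := by
    rintro _ _ ⟨a, ha, rfl⟩ ⟨b, hb, rfl⟩
    exact ⟨a + b, S.add_mem ha hb, map_add _ _ _⟩
  zero_mem' := ⟨0, S.zero_mem, map_zero _⟩
  smul_mem' := by
    rintro q _ ⟨a, ha, rfl⟩
    exact ⟨a * rhToZ n q, S.mul_mem ha (hS q), (rightMul_zToMExt _ a).symm⟩

/-! ### A filtration of the words of given length -/

/-- The depth of a generator: it decreases under the adjoint action of `t⁺`. -/
def depth (p : ℤˣ × Fin n) : ℕ := if p.1 = 1 then p.2 else n - p.2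

/-- The depth of a word, the sum of the depths of its letters. -/
def wordDepth (l : List (ℤˣ × Fin n)) : ℕ := (l.map depth).sum

theorem E_lie_word {i j : Fin n} (hij : i < j) (l : List (ℤˣ × Fin n)) :
    ⁅E i j, word l⁆ ∈ AddSubgroup.closure
      (word '' {l' : List (ℤˣ × Fin n) | l'.length = l.length ∧ wordDepth l' < wordDepth l}) := by
  induction l with
  | nil => rw [word_nil, Ring.lie_def, mul_one, one_mul, sub_self]; exact AddSubgroup.zero_mem _
  | cons p l ih =>
    have e : ⁅E i j, word (p :: l)⁆
        = ⁅E i j, B p.1 p.2⁆ * word l + B p.1 p.2 * ⁅E i j, word l⁆ := by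
      rw [word_cons]
      simp only [Ring.lie_def]
      noncomm_ring
    rw [e]
    refine AddSubgroup.add_mem _ ?_ ?_
    · obtain ⟨ε, k⟩ := p
      have hj := j.2
      have hij' := Fin.lt_def.1 hij
      rcases Int.units_eq_one_or ε with rfl | rfl
      · rw [E_lie_B_pos]
        split_ifs with h
        · subst h
          refine AddSubgroup.subset_closure ⟨(1, i) :: l, ⟨rfl, ?_⟩, word_cons _ _⟩
          simpa [wordDepth, depth] using hij'
        · rw [zero_mul]; exact AddSubgroup.zero_mem _
      · rw [E_lie_B_neg]
        split_ifs with h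
        · subst h
          rw [neg_mul]
          refine AddSubgroup.neg_mem _
            (AddSubgroup.subset_closure ⟨(-1, j) :: l, ⟨rfl, ?_⟩, word_cons _ _⟩)
          simp only [wordDepth, depth, List.map_cons, List.sum_cons, add_lt_add_iff_right]
          rw [if_neg (by decide), if_neg (by decide)]
          omega
        · rw [neg_zero, zero_mul]; exact AddSubgroup.zero_mem _
    · have h := AddSubgroup.mem_map_of_mem (AddMonoidHom.mulLeft (B p.1 p.2)) ih
      rw [AddMonoidHom.map_closure] at h
      refine AddSubgroup.closure_mono ?_ h
      rintro _ ⟨_, ⟨l', ⟨h1, h2⟩, rfl⟩, rfl⟩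
      refine ⟨p :: l', ⟨by simp [h1], ?_⟩, word_cons _ _⟩
      simpa [wordDepth] using h2

/-- The subspace of `M'(g, t)` spanned by the words of length `d` and depth less than `m`. -/
noncomputable def lowWords (n d m : ℕ) : Submodule (Rh n) (MExt n) :=
  Submodule.span (Rh n)
    ((fun l => mkMExt n (word l)) '' {l | l.length = d ∧ wordDepth l < m})

theorem op_mkMExt_word {i j : Fin n} (hij : i < j) (l : List (ℤˣ × Fin n)) :
    op i j (mkMExt n (word l)) ∈ lowWords n l.length (wordDepth l) := by
  have e : op i j (mkMExt n (word l)) = (JExt n).mkQ (toUExt n ⁅E i j, word l⁆) := by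
    have h0 : (JExt n).mkQ (toUExt n (word l * E i j)) = 0 := by
      rw [(toUExt n).map_mul, Submodule.mkQ_apply, Submodule.Quotient.mk_eq_zero]
      exact Submodule.smul_mem _ _ (Submodule.subset_span ⟨i, j, hij, rfl⟩)
    rw [Ring.lie_def, (toUExt n).map_sub, map_sub, h0, sub_zero, (toUExt n).map_mul]
    rfl
  rw [e]
  have h := E_lie_word hij l
  generalize ⁅E i j, word l⁆ = x at h ⊢
  induction h using AddSubgroup.closure_induction with
  | mem x hx =>
    obtain ⟨l', hl', rfl⟩ := hx
    exact Submodule.subset_span ⟨l', hl', rfl⟩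
  | zero => rw [map_zero, map_zero]; exact Submodule.zero_mem _
  | add x y _ _ hx hy => rw [map_add, map_add]; exact Submodule.add_mem _ hx hy
  | neg x _ hx => rw [map_neg, map_neg]; exact Submodule.neg_mem _ hx

theorem op_mem_lowWords {i j : Fin n} (hij : i < j) {d m : ℕ} {u : MExt n}
    (hu : u ∈ lowWords n d m) : op i j u ∈ lowWords n d m := by
  induction hu using Submodule.span_induction with
  | mem u hu =>
    obtain ⟨l, ⟨h1, h2⟩, rfl⟩ := hu
    refine Submodule.span_mono (Set.image_mono ?_) (op_mkMExt_word hij l)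
    exact fun l' h => ⟨h.1.trans h1, h.2.trans h2⟩
  | zero => rw [map_zero]; exact Submodule.zero_mem _
  | add x y _ _ hx hy => rw [map_add]; exact Submodule.add_mem _ hx hy
  | smul q x _ hx => rw [map_smul]; exact Submodule.smul_mem _ _ hx

theorem rhToUExt_smul_mem_lowWords (q : Rh n) {d m : ℕ} {u : MExt n}
    (hu : u ∈ lowWords n d m) : rhToUExt n q • u ∈ lowWords n d m := by
  induction hu using Submodule.span_induction with
  | mem u hu =>
    obtain ⟨l, hl, rfl⟩ := hu
    obtain ⟨μ, hμ⟩ := exists_hasWeight_word l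
    obtain ⟨q', h⟩ := rh_mul_weight hμ q
    have e : rhToUExt n q • mkMExt n (word l) = q' • mkMExt n (word l) := by
      rw [mkMExt, ← map_smul, smul_eq_mul, h, rh_smul_mk]
    exact e ▸ Submodule.smul_mem _ _ (Submodule.subset_span ⟨l, hl, rfl⟩)
  | zero => rw [smul_zero]; exact Submodule.zero_mem _
  | add x y _ _ hx hy => rw [smul_add]; exact Submodule.add_mem _ hx hy
  | smul p x _ hx => rw [smul_comm]; exact Submodule.smul_mem _ _ hx

/-! ### Subspaces stable under `t⁻` -/

/-- The smallest `R(h)`-subspace that contains `W` and is stable under `t⁻`. -/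
noncomputable def lowerClosure (W : Submodule (Rh n) (MExt n)) : Submodule (Rh n) (MExt n) :=
  sInf {Y | W ≤ Y ∧ ∀ i j : Fin n, i < j → ∀ u ∈ Y, op j i u ∈ Y}

theorem le_lowerClosure (W : Submodule (Rh n) (MExt n)) : W ≤ lowerClosure W :=
  le_sInf fun _ hY => hY.1

theorem lowerClosure_le {W Y : Submodule (Rh n) (MExt n)} (h : W ≤ Y)
    (hY : ∀ i j : Fin n, i < j → ∀ u ∈ Y, op j i u ∈ Y) : lowerClosure W ≤ Y := sInf_le ⟨h, hY⟩

theorem op_mem_lowerClosure {W : Submodule (Rh n) (MExt n)} {i j : Fin n} (hij : i < j) {u : MExt n}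
    (hu : u ∈ lowerClosure W) : op j i u ∈ lowerClosure W := by
  rw [lowerClosure, Submodule.mem_sInf] at hu ⊢
  exact fun Y hY => hY.2 i j hij u (hu Y hY)

/-- If `W` is stable under `t⁺` and the left action of `R(h)`, then so is the subspace that it
generates under `t⁻`. -/
theorem lowerClosure_stable {W : Submodule (Rh n) (MExt n)}
    (he : ∀ i j : Fin n, i < j → ∀ u ∈ W, op i j u ∈ W) (hq : ∀ q, ∀ u ∈ W, rhToUExt n q • u ∈ W)
    {u : MExt n} (hu : u ∈ lowerClosure W) :
    (∀ i j : Fin n, i < j → op i j u ∈ lowerClosure W) ∧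
      ∀ q, rhToUExt n q • u ∈ lowerClosure W := by
  let Y : Submodule (Rh n) (MExt n) :=
    { carrier := {u | u ∈ lowerClosure W ∧ (∀ i j : Fin n, i < j → op i j u ∈ lowerClosure W) ∧
        ∀ q, rhToUExt n q • u ∈ lowerClosure W}
      add_mem' := fun {x y} hx hy => ⟨Submodule.add_mem _ hx.1 hy.1,
        fun i j hij => by rw [map_add]; exact Submodule.add_mem _ (hx.2.1 i j hij) (hy.2.1 i j hij),
        fun q => by rw [smul_add]; exact Submodule.add_mem _ (hx.2.2 q) (hy.2.2 q)⟩
      zero_mem' := ⟨Submodule.zero_mem _,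
        fun i j _ => by rw [map_zero]; exact Submodule.zero_mem _,
        fun q => by rw [smul_zero]; exact Submodule.zero_mem _⟩
      smul_mem' := fun c x hx => ⟨Submodule.smul_mem _ _ hx.1,
        fun i j hij => by rw [map_smul]; exact Submodule.smul_mem _ _ (hx.2.1 i j hij),
        fun q => by rw [smul_comm]; exact Submodule.smul_mem _ _ (hx.2.2 q)⟩ }
  suffices h : lowerClosure W ≤ Y from (h hu).2
  refine lowerClosure_le (fun u hu => ⟨le_lowerClosure W hu,
    fun i j hij => le_lowerClosure W (he i j hij u hu),
    fun q => le_lowerClosure W (hq q u hu)⟩) ?_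
  rintro k l hkl u ⟨h1, h2, h3⟩
  have hall : ∀ i j : Fin n, op i j u ∈ lowerClosure W := by
    intro i j
    rcases lt_trichotomy i j with h | rfl | h
    · exact h2 i j h
    · rw [op_apply, ← cartan_X, ← rhToUExt_algebraMap]
      exact h3 _
    · exact op_mem_lowerClosure h h1
  refine ⟨op_mem_lowerClosure hkl h1, fun i j hij => ?_, fun q => ?_⟩
  · have h := LinearMap.congr_fun (op_mul_op i j l k) u
    simp only [Module.End.mul_apply, LinearMap.add_apply, LinearMap.sub_apply] at h
    rw [h]
    refine Submodule.add_mem _ (op_mem_lowerClosure hkl (h2 i j hij)) (Submodule.sub_mem _ ?_ ?_)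
    · split_ifs
      · exact hall _ _
      · exact Submodule.zero_mem _
    · split_ifs
      · exact hall _ _
      · exact Submodule.zero_mem _
  · obtain ⟨q', h⟩ := rh_mul_weight (hasWeight_E l k) q
    rw [op_apply, smul_smul, h, mul_smul]
    exact op_mem_lowerClosure hkl (h3 q')

theorem extremalFactor_mem_of_stable {Y : Submodule (Rh n) (MExt n)}
    (hE : ∀ i j : Fin n, i ≠ j → ∀ u ∈ Y, op i j u ∈ Y) (hq : ∀ q, ∀ u ∈ Y, rhToUExt n q • u ∈ Y)
    {i j : Fin n} (hij : i ≠ j) {u : MExt n} (hu : u ∈ Y) : extremalFactor i j u ∈ Y := by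
  have hpow : ∀ i j : Fin n, i ≠ j → ∀ (k : ℕ), ∀ u ∈ Y, toUExt n (E i j) ^ k • u ∈ Y := by
    intro i j hij k
    induction k with
    | zero => intro u hu; simpa using hu
    | succ k ih =>
      intro u hu
      rw [pow_succ, mul_smul]
      exact ih _ (hE i j hij u hu)
  refine finsum_induction (· ∈ Y) Y.zero_mem (fun x y hx hy => Y.add_mem hx hy) fun k => ?_
  rw [extremalTerm, Algebra.smul_def, mul_smul, algebraMap_smul_MExt, mul_smul, mul_smul]
  exact Y.smul_mem _ (hpow j i hij.symm k _ (hpow i j hij k _ (hq _ _ hu)))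

/-- Modulo the subspace generated under `t⁻` by words of smaller depth, the extremal projector fixes
every word. -/
theorem projector_word_sub_mem (l : List (ℤˣ × Fin n)) :
    projector n (mkMExt n (word l)) - mkMExt n (word l)
      ∈ lowerClosure (lowWords n l.length (wordDepth l)) := by
  set Y := lowerClosure (lowWords n l.length (wordDepth l)) with hY
  set w := mkMExt n (word l) with hw
  have hst : ∀ u ∈ Y, (∀ i j : Fin n, i < j → op i j u ∈ Y) ∧ ∀ q, rhToUExt n q • u ∈ Y :=
    fun u hu => lowerClosure_stable (fun _ _ hij _ hu => op_mem_lowWords hij hu)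
      (fun q _ hu => rhToUExt_smul_mem_lowWords q hu) hu
  have hE : ∀ i j : Fin n, i ≠ j → ∀ u ∈ Y, op i j u ∈ Y := by
    intro i j hij u hu
    rcases lt_or_gt_of_ne hij with h | h
    · exact (hst u hu).1 i j h
    · exact op_mem_lowerClosure h hu
  have hpow : ∀ i j : Fin n, i ≠ j → ∀ (k : ℕ), ∀ u ∈ Y, (op i j ^ k) u ∈ Y := by
    intro i j hij k
    induction k with
    | zero => exact fun u hu => hu
    | succ k ih =>
      intro u hu
      rw [pow_succ, Module.End.mul_apply]
      exact ih _ (hE i j hij u hu)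
  obtain ⟨μ, hμ⟩ := exists_hasWeight_word l
  have hwμ : w ∈ mWeight μ := mkMExt_mem_mWeight hμ
  have hone : ∀ i j : Fin n, i < j → extremalFactor i j w - w ∈ Y := by
    intro i j hij
    obtain ⟨N, hN⟩ := exists_op_pow_eq_zero hij w
    rw [extremalFactor_eq_projSum hwμ hij (N := N + 1)
      fun k hk => hN k (by omega), projSum, Finset.sum_range_succ']
    simp only [projCoeff_zero, pow_zero, Module.End.one_apply, one_smul, add_sub_cancel_right]
    refine Submodule.sum_mem _ fun k _ => Submodule.smul_mem _ _ (hpow j i hij.ne' _ _ ?_)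
    rw [pow_succ, Module.End.mul_apply]
    exact hpow i j hij.ne k _ (le_lowerClosure _ (op_mkMExt_word hij l))
  change factorProd (normalOrder n) w - w ∈ Y
  have hL := positive_normalOrder (n := n)
  generalize normalOrder n = L at hL ⊢
  induction L with
  | nil => rw [factorProd_nil, sub_self]; exact Submodule.zero_mem _
  | cons a L ih =>
    have ha := hL a List.mem_cons_self
    have h1 := ih fun b hb => hL b (List.mem_cons_of_mem _ hb)
    rw [factorProd_cons, ← sub_add_cancel (factorProd L w) w, extremalFactor_add ha, add_sub_assoc]
    exact Submodule.add_mem _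
      (extremalFactor_mem_of_stable hE (fun q u hu => (hst u hu).2 q) ha.ne h1)
      (hone _ _ ha)

/-! ### Generation -/

/-- The vectors `u` such that `p (B_j^ε u)` lies in `Y` for all `ε`, `j`. -/
noncomputable def goodVectors (Y : Submodule (Rh n) (MExt n)) : Submodule (Rh n) (MExt n) where
  carrier := {u | ∀ (ε : ℤˣ) (j : Fin n), projector n (toUExt n (B ε j) • u) ∈ Y}
  add_mem' hu hv ε j := by rw [smul_add, map_add]; exact Y.add_mem (hu ε j) (hv ε j)
  zero_mem' ε j := by rw [smul_zero, map_zero]; exact Y.zero_mem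
  smul_mem' q u hu ε j := by rw [smul_comm, map_smul]; exact Y.smul_mem q (hu ε j)

theorem op_mem_goodVectors {Y : Submodule (Rh n) (MExt n)} {i j : Fin n} (hij : i < j) {u : MExt n}
    (hu : u ∈ goodVectors Y) : op j i u ∈ goodVectors Y := by
  intro ε k
  have e : toUExt n (B ε k) • op j i u
      = op j i (toUExt n (B ε k) • u) - toUExt n ⁅E j i, B ε k⁆ • u := by
    rw [Ring.lie_def, map_sub, map_mul, map_mul, sub_smul, mul_smul, mul_smul, op_apply, op_apply]
    abel
  rw [e, map_sub, projector_op hij, zero_sub]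
  refine Y.neg_mem ?_
  rcases Int.units_eq_one_or ε with rfl | rfl
  · rw [E_lie_B_pos]
    split_ifs
    · exact hu _ _
    · rw [map_zero, zero_smul, map_zero]; exact Y.zero_mem
  · rw [E_lie_B_neg]
    split_ifs
    · rw [map_neg, neg_smul, map_neg]; exact Y.neg_mem (hu _ _)
    · rw [neg_zero, map_zero, zero_smul, map_zero]; exact Y.zero_mem

/-- The elements `p B_j^ε` alone generate `Z(g, t)` over `R(h)`. -/
theorem subring_eq_top (S : Subring (Z n)) (hS : ∀ q, rhToZ n q ∈ S)
    (hB : ∀ (ε : ℤˣ) (j : Fin n), ∀ z, zToMExt n z = projector n (mkMExt n (B ε j)) → z ∈ S) :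
    S = ⊤ := by
  set Y := subringImage S hS with hY
  have hB' : ∀ (ε : ℤˣ) (j : Fin n), projector n (mkMExt n (B ε j)) ∈ Y := by
    intro ε j
    obtain ⟨z, hz⟩ := projector_mem_range (mkMExt n (B ε j))
    exact ⟨z, hB ε j z hz, hz⟩
  have hZ : ∀ z ∈ S, zToMExt n z ∈ goodVectors Y := by
    intro z hz ε j
    obtain ⟨v, rfl⟩ := Ideal.Quotient.mk_surjective z
    obtain ⟨b, hb, e⟩ := hB' ε j
    have h1 : toUExt n (B ε j) • zToMExt n (Ideal.Quotient.mk (jIdeal n) v)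
        = rightMul v (mkMExt n (B ε j)) := rfl
    rw [h1, ← map_projector, ← e, rightMul_zToMExt]
    exact ⟨_, S.mul_mem hb hz, rfl⟩
  have hword : ∀ (d : ℕ) (l : List (ℤˣ × Fin n)), l.length = d →
      projector n (mkMExt n (word l)) ∈ Y := by
    intro d
    induction d with
    | zero =>
      intro l hl
      rw [List.length_eq_zero_iff.1 hl, word_nil]
      have h1 : mkMExt n 1 = zToMExt n 1 := by rw [mkMExt, map_one]; rfl
      rw [h1, projector_zToMExt]
      exact ⟨1, S.one_mem, rfl⟩
    | succ d ih =>
      -- words of length `d` are good, by induction on their depth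
      have hgood : ∀ (m : ℕ) (l : List (ℤˣ × Fin n)), l.length = d → wordDepth l = m →
          mkMExt n (word l) ∈ goodVectors Y := by
        intro m
        induction m using Nat.strong_induction_on with
        | _ m ihm =>
          intro l hl hm
          obtain ⟨z, hz, e⟩ := ih l hl
          have h1 := projector_word_sub_mem l
          have h2 : lowerClosure (lowWords n l.length (wordDepth l)) ≤ goodVectors Y := by
            refine lowerClosure_le (Submodule.span_le.2 ?_)
              fun i j hij u hu => op_mem_goodVectors hij hu
            rintro _ ⟨l', ⟨h3, h4⟩, rfl⟩
            exact ihm _ (hm ▸ h4) l' (h3.trans hl) rfl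
          have h5 := Submodule.sub_mem _ (hZ z hz) (h2 h1)
          rwa [e, sub_sub_cancel] at h5
      intro l hl
      obtain ⟨p, l, rfl⟩ := List.exists_cons_of_length_eq_add_one hl
      have h1 := hgood _ l (by simpa using hl) rfl p.1 p.2
      have h2 : mkMExt n (word (p :: l)) = toUExt n (B p.1 p.2) • mkMExt n (word l) := by
        rw [mkMExt, word_cons, map_mul, mkMExt, ← map_smul, smul_eq_mul]
      rwa [h2]
  have hall : ∀ u : MExt n, projector n u ∈ Y := by
    have : (⊤ : Submodule (Rh n) (MExt n)) ≤ Y.comap (projector n) := by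
      rw [← span_mkMExt_word, Submodule.span_le]
      rintro _ ⟨l, rfl⟩
      exact hword _ l rfl
    exact fun u => this Submodule.mem_top
  rw [eq_top_iff]
  rintro z -
  obtain ⟨z', hz', e⟩ := hall (zToMExt n z)
  rw [projector_zToMExt] at e
  exact zToMExt_injective n e ▸ hz'

end OspMZ

/-- The elements `p B_j^±`, `p {B_i^±, B_j^±}` of `M'(g, t)` lie in `Z(g, t)`, and together with
`R(h)` they generate the ring `Z(g, t)`. -/
theorem mainTheorem10 (n : ℕ) :
    OspMZ.generators n ⊆ Set.range (OspMZ.zToMExt n) ∧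
      Subring.closure (Set.range (OspMZ.rhToZ n) ∪
        {z : OspMZ.Z n | OspMZ.zToMExt n z ∈ OspMZ.generators n}) = ⊤ := by
  constructor
  · rintro u (⟨ε, j, rfl⟩ | ⟨ε, i, j, -, rfl⟩)
    · exact OspMZ.projector_mem_range _
    · exact OspMZ.projector_mem_range _
  · exact OspMZ.subring_eq_top _ (fun q => Subring.subset_closure (Or.inl ⟨q, rfl⟩))
      fun ε j z hz => Subring.subset_closure (Or.inr (Or.inl ⟨ε, j, hz⟩))
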